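/- Let $n_{\mathrm t},n_{\mathrm r}$ be natural numbers, and let $\mathbf\Sigma\in\mathbb C^{n_{\mathrm t}\times n_{\mathrm t}}$ and $\mathbf\Psi\in\mathbb C^{n_{\mathrm r}n_{\mathrm t}\times n_{\mathrm r}n_{\mathrm t}}$ be Hermitian positive semidefinite matrices with $\operatorname{tr}\mathbf\Sigma=1$ (real symmetric matrices are a special case). Let $\mathbf H_1,\mathbf H_2,\dots$ be i.i.d. random $n_{\mathrm r}\times n_{\mathrm t}$ complex matrices with $\operatorname{vec}(\mathbf H_k^\dagger)\sim\mathcal{CN}(\mathbf 0,\mathbf\Psi)$ (circularly-symmetric complex Gaussian), and let $\rho>0$. For $K\ge 1$, use the $K$ parallel channels $\mathbf Y_k=\mathbf H_k\mathbf X_k+\mathbf Z_k$, $k=1,\dots,K$, with independent input $\mathbf X_k\sim\mathcal{CN}(\mathbf 0,(\rho/K)\mathbf\Sigma)$ and noise $\mathbf Z_k\sim\mathcal{CN}(\mathbf 0,\mathbf I)$. Let $J(\gamma,\mathbf h)$ be the mutual information, in nats, between $\mathbf X\sim\mathcal{CN}(\mathbf 0,\gamma\mathbf\Sigma)$ and $\mathbf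 h\mathbf X+\mathbf Z$, and let $R(K,\rho)=\sum_{k=1}^K J(\rho/K,\mathbf H_k)$ be the total achievable rate given the fading realization. For a target rate $r\ge 0$ the outage probability is $\mathcal O(K,\rho,r)=\Pr[R(K,\rho)\le r]$. The wideband minimum energy per nat $\bar\eta\in[0,\infty]$ is the infimum of all $\eta>0$ with $\mathcal O(K,\rho,\rho/\eta)\to0$ as $K\to\infty$ (with $\inf\emptyset=\infty$). Put $\mathbf M=(\mathbf I_{n_{\mathrm r}\times n_{\mathrm r}}\otimes\mathbf\Sigma)\mathbf\Psi$. Then $\operatorname{tr}\mathbf M$ is real and nonnegative, $\det(\mathbf I-\lambda\mathbf M)$ is real and positive for every real $\lambda\le0$, and $$\bar\eta=\frac1{\operatorname{tr}\mathbf M}\qquad(\text{read as }\infty\text{ if }\operatorname{tr}\mathbf M=0).$$ Moreover the energy per nat $\rho/R(K,\rho)$ converges in probability to $\bar\eta$ as $K\to\infty$ (with $\rho/0=\infty$; if $\bar\eta=\infty$, this means $\Pr[R(K,\rho)\neq0]\to0$), and for every real $\eta\ge\bar\eta$ the wideband outage exponent exists and equals $$\mathcal E(\eta):=\lim_{K\to\infty}\frac{-\log\mathcal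 O(K,\rho,\rho/\eta)}{K}=\sup_{\lambda\le0}\left\{\frac{\lambda}{\eta}+\log\det(\mathbf I-\lambda\mathbf M)\right\}.$$ -/

import Mathlib

open MeasureTheory ProbabilityTheory Filter Topology Matrix
open scoped ENNReal ComplexOrder MatrixOrder Kronecker

noncomputable section

namespace WidebandMIMO

/-- The scalar law `CN(0,1)`: real and imaginary parts are independent real Gaussians with mean `0`
and variance `1/2`. -/
def stdComplexGaussian : Measure ℂ :=
  ((gaussianReal 0 (1 / 2)).prod (gaussianReal 0 (1 / 2))).map Complex.measurableEquivRealProd.symm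

/-- The circularly-symmetric complex Gaussian law `CN(0,C)` on `ι → ℂ` with (positive semidefinite)
covariance matrix `C`: the law of `C^{1/2} W`, where `W` has i.i.d. `CN(0,1)` entries. -/
def complexGaussian {ι : Type*} [Fintype ι] [DecidableEq ι] (C : Matrix ι ι ℂ) : Measure (ι → ℂ) :=
  (Measure.pi fun _ : ι => stdComplexGaussian).map fun w => CFC.sqrt C *ᵥ w

/-- Mutual information (in nats) between the two coordinates of a joint law `μ`: the
Kullback-Leibler divergence of `μ` from the product of its marginals. -/
def mutualInfo {α β : Type*} [MeasurableSpace α] [MeasurableSpace β] (μ : Measure (α × β)) : ℝ≥0∞ :=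
  InformationTheory.klDiv μ (μ.fst.prod μ.snd)

/-- Joint law of the input `X ∼ CN(0,C)` and the output `Y = hX + Z`, where the noise `Z ∼ CN(0,I)`
is independent of `X`. -/
def inputOutputLaw {nt nr : ℕ} (C : Matrix (Fin nt) (Fin nt) ℂ) (h : Matrix (Fin nr) (Fin nt) ℂ) :
    Measure ((Fin nt → ℂ) × (Fin nr → ℂ)) :=
  ((complexGaussian C).prod (complexGaussian (1 : Matrix (Fin nr) (Fin nr) ℂ))).map
    fun p => (p.1, h *ᵥ p.1 + p.2)

/-- Rate `J(γ,h)` of one channel with fading matrix `h` and input law `CN(0,γS)`. -/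
def channelRate {nt nr : ℕ} (S : Matrix (Fin nt) (Fin nt) ℂ) (γ : ℝ)
    (h : Matrix (Fin nr) (Fin nt) ℂ) : ℝ≥0∞ :=
  mutualInfo (inputOutputLaw ((γ : ℂ) • S) h)

section Model

variable {nt nr : ℕ} {Ω : Type*} [MeasurableSpace Ω] (P : Measure Ω)
  (S : Matrix (Fin nt) (Fin nt) ℂ) (H : ℕ → Ω → Matrix (Fin nr) (Fin nt) ℂ) (ρ : ℝ)

/-- Total achievable rate `R(K,ρ)` over the first `K` parallel channels, the input of each having
covariance `(ρ/K)S`, as a function of the fading realization. -/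
def totalRate (K : ℕ) (ω : Ω) : ℝ≥0∞ :=
  ∑ k ∈ Finset.range K, channelRate S (ρ / K) (H k ω)

/-- Outage probability `Pr[R(K,ρ) ≤ r]`. -/
def outageProb (K : ℕ) (r : ℝ) : ℝ≥0∞ :=
  P {ω | totalRate S H ρ K ω ≤ ENNReal.ofReal r}

/-- Wideband minimum energy per nat: the infimum of all energies per nat `η = ρ/r` at which the
outage probability vanishes as `K → ∞` (it is `∞` if there is no such `η`). -/
def minEnergyPerNat : ℝ≥0∞ :=
  sInf {e | ∃ η : ℝ, 0 < η ∧ e = ENNReal.ofReal η ∧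
    Tendsto (fun K : ℕ => outageProb P S H ρ K (ρ / η)) atTop (𝓝 0)}

/-- `E` is the wideband outage exponent at energy per nat `η = ρ/r`: the limit of
`-log Pr[R(K,ρ) ≤ ρ/η] / K` as `K → ∞`. -/
def HasOutageExponent (η : ℝ) (E : EReal) : Prop :=
  Tendsto (fun K : ℕ => -ENNReal.log (outageProb P S H ρ K (ρ / η)) / (K : EReal)) atTop (𝓝 E)

end Model

end WidebandMIMO

end

/-! Everything reduces to the i.i.d. power gains `X_k = tr(H_k S H_k†)`. The rate of a Gaussian
channel is `log det(1 + G†G)` with `G = h (γS)^{1/2}`, and the eigenvalues of `G†G` give `log(1 +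
γX) ≤ J(γ, h) ≤ γX` (`le_channelRate`, `channelRate_le`). At `γ = ρ/K` the two bounds agree to first
order, so `R(K, ρ)/ρ` behaves like the empirical mean of the gains, and outage at rate `ρ/η` like
the event that this mean is at most `a = 1/η`.

As `vec H_k†` has the law of `Ψ^{1/2} W` with `W` standard, `X_k` has the law of `W† N W` for the
positive semidefinite `N = Ψ^{1/2} (I ⊗ S) Ψ^{1/2}`. Hence `E exp(-sX) = 1 / det(1 + sN)` for `s ≥
0` and `E X = tr N`. Cyclicity gives `tr N = tr M` and `det(1 + tN) = det(1 + tM)`.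

What remains is Cramér's theorem for the lower tail. Chernoff's bound for the logarithmic lower
bound yields the exponent `-sa + log det(1 + sN)` for each `s ≥ 0` (`measure_log_le`). Exponential
tilting for the linear upper bound shows that nothing better is possible when `0 < a ≤ tr N`
(`le_measure_sum_le`). With `λ = -s` this is the stated supremum. For `a < tr N` some Chernoff
exponent is positive, and for `a > tr N` the law of large numbers keeps the outage from vanishing.
This locates the minimum energy, and the same two tails give convergence in probability. -/

noncomputable section

namespace WidebandMIMO

/-! ### Determinant and trace of positive semidefinite matrices -/

section LinearAlgebra

theorem one_add_sum_le_prod_one_add {ι : Type*} {f : ι → ℝ} (hf : ∀ i, 0 ≤ f i) (s : Finset ι) :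
    1 + ∑ i ∈ s, f i ≤ ∏ i ∈ s, (1 + f i) := by
  classical
  induction s using Finset.induction_on with
  | empty => simp
  | insert a s ha ih =>
    rw [Finset.sum_insert ha, Finset.prod_insert ha]
    have h1 : 0 ≤ ∑ i ∈ s, f i := Finset.sum_nonneg fun i _ => hf i
    nlinarith [hf a, mul_nonneg (hf a) h1]

variable {ι : Type*} [Fintype ι] [DecidableEq ι]

theorem det_one_add_smul_eq_prod_eigenvalues {N : Matrix ι ι ℂ} (hN : N.IsHermitian) (t : ℂ) :
    (1 + t • N).det = ∏ i, (1 + t * (hN.eigenvalues i : ℂ)) := by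
  have hU : (hN.eigenvectorUnitary : Matrix ι ι ℂ) * star (hN.eigenvectorUnitary : Matrix ι ι ℂ) = 1 :=
    Unitary.mul_star_self_of_mem hN.eigenvectorUnitary.2
  have h : 1 + t • N = (hN.eigenvectorUnitary : Matrix ι ι ℂ) *
      (1 + t • diagonal (fun i => (hN.eigenvalues i : ℂ))) *
        star (hN.eigenvectorUnitary : Matrix ι ι ℂ) := by
    rw [mul_add, add_mul, mul_one, hU, mul_smul_comm, smul_mul_assoc]
    conv_lhs => rw [hN.spectral_theorem, Unitary.conjStarAlgAut_apply]
    rfl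
  have hd : (1 : Matrix ι ι ℂ) + t • diagonal (fun i => (hN.eigenvalues i : ℂ)) =
      diagonal (fun i => 1 + t * (hN.eigenvalues i : ℂ)) := by
    rw [← diagonal_one, ← diagonal_smul, diagonal_add]
    rfl
  rw [h, det_mul_right_comm, hU, one_mul, hd, det_diagonal]

theorem det_one_add_re {N : Matrix ι ι ℂ} (hN : N.IsHermitian) :
    (1 + N).det.re = ∏ i, (1 + hN.eigenvalues i) := by
  have := det_one_add_smul_eq_prod_eigenvalues hN 1
  rw [one_smul] at this
  rw [this]
  norm_cast
  simp

theorem trace_re_eq_sum {N : Matrix ι ι ℂ} (hN : N.IsHermitian) :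
    N.trace.re = ∑ i, hN.eigenvalues i := by
  rw [hN.trace_eq_sum_eigenvalues]; simp

/-- In the expansion of `∏ (1 + λ i)` the terms of order two and higher are nonnegative. Together
with `log (1 + λ) ≤ λ`, used in the next lemma, this traps the log-determinant between two functions
of the trace alone. -/
theorem one_add_trace_le_det {N : Matrix ι ι ℂ} (hN : N.PosSemidef) :
    1 + N.trace.re ≤ (1 + N).det.re := by
  rw [det_one_add_re hN.1, trace_re_eq_sum hN.1]
  exact one_add_sum_le_prod_one_add hN.eigenvalues_nonneg _

theorem log_det_one_add_le_trace {N : Matrix ι ι ℂ} (hN : N.PosSemidef) :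
    Real.log (1 + N).det.re ≤ N.trace.re := by
  have hpos (i : ι) : 0 < 1 + hN.1.eigenvalues i := by have := hN.eigenvalues_nonneg i; positivity
  rw [det_one_add_re hN.1, trace_re_eq_sum hN.1, Real.log_prod fun i _ => (hpos i).ne']
  refine Finset.sum_le_sum fun i _ => ?_
  linarith [Real.log_le_sub_one_of_pos (hpos i)]

theorem sqrt_mul_sqrt {C : Matrix ι ι ℂ} (hC : C.PosSemidef) :
    CFC.sqrt C * CFC.sqrt C = C :=
  CFC.sqrt_mul_sqrt_self C (nonneg_iff_posSemidef.2 hC)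

theorem posSemidef_sqrt (C : Matrix ι ι ℂ) : (CFC.sqrt C).PosSemidef :=
  nonneg_iff_posSemidef.1 (CFC.sqrt_nonneg C)

end LinearAlgebra

/-! ### Densities and Gaussian integrals for standard complex vectors -/

section GaussianDensity

/-- The quadratic form `v ↦ v† A v` of a Hermitian matrix `A`. -/
def quadForm {ι : Type*} [Fintype ι] (A : Matrix ι ι ℂ) (v : ι → ℂ) : ℝ :=
  (star v ⬝ᵥ (A *ᵥ v)).re

/-- It suffices to compare boxes, where the indicator times the product density is again a product
and its integral factors. -/
theorem pi_withDensity_ofReal {ι : Type*} [Fintype ι] {α : ι → Type*}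
    [∀ i, MeasurableSpace (α i)] (μ : ∀ i, Measure (α i)) [∀ i, SigmaFinite (μ i)]
    (f : ∀ i, α i → ℝ) (hf0 : ∀ i x, 0 ≤ f i x)
    (hfi : ∀ i, Integrable (f i) (μ i)) :
    Measure.pi (fun i => (μ i).withDensity fun x => ENNReal.ofReal (f i x)) =
      (Measure.pi μ).withDensity fun x => ENNReal.ofReal (∏ i, f i (x i)) := by
  have (i : ι) : IsFiniteMeasure ((μ i).withDensity fun x => ENNReal.ofReal (f i x)) :=
    isFiniteMeasure_withDensity_ofReal (hfi i).2
  refine Measure.pi_eq fun s hs => ?_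
  have hind (i : ι) : Integrable ((s i).indicator (f i)) (μ i) := (hfi i).indicator (hs i)
  have hnn (i : ι) (x : α i) : 0 ≤ (s i).indicator (f i) x :=
    Set.indicator_nonneg (fun _ _ => hf0 i _) _
  have key (x : ∀ i, α i) : (Set.univ.pi s).indicator (fun x => ENNReal.ofReal (∏ i, f i (x i))) x =
      ENNReal.ofReal (∏ i, (s i).indicator (f i) (x i)) := by
    by_cases hx : x ∈ Set.univ.pi s
    · rw [Set.indicator_of_mem hx]
      congr 1
      refine Finset.prod_congr rfl fun i _ => ?_
      rw [Set.indicator_of_mem (hx i trivial)]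
    · rw [Set.indicator_of_notMem hx]
      simp only [Set.mem_univ_pi, not_forall] at hx
      obtain ⟨i, hi⟩ := hx
      rw [Finset.prod_eq_zero (Finset.mem_univ i) (Set.indicator_of_notMem hi _)]
      simp
  rw [withDensity_apply _ (MeasurableSet.univ_pi hs), ← lintegral_indicator (MeasurableSet.univ_pi hs)]
  simp_rw [key]
  rw [← ofReal_integral_eq_lintegral_ofReal (Integrable.fintype_prod_dep hind)
    (ae_of_all _ fun x => Finset.prod_nonneg fun i _ => hnn i _), integral_fintype_prod_eq_prod,
    ENNReal.ofReal_prod_of_nonneg fun i _ => integral_nonneg (hnn i)]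
  refine Finset.prod_congr rfl fun i _ => ?_
  rw [withDensity_apply _ (hs i), ← ofReal_integral_eq_lintegral_ofReal (hfi i).integrableOn
    (ae_of_all _ (hf0 i)), integral_indicator (hs i)]

instance isProbabilityMeasure_stdComplexGaussian : IsProbabilityMeasure stdComplexGaussian :=
  Measure.isProbabilityMeasure_map Complex.measurableEquivRealProd.symm.measurable.aemeasurable

theorem stdComplexGaussian_eq_withDensity :
    stdComplexGaussian =
      volume.withDensity fun z => ENNReal.ofReal (Real.pi⁻¹ * Real.exp (-Complex.normSq z)) := by
  have hv : (1 / 2 : NNReal) ≠ 0 := by norm_num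
  unfold stdComplexGaussian
  rw [gaussianReal_of_var_ne_zero _ hv,
    prod_withDensity (measurable_gaussianPDF _ _) (measurable_gaussianPDF _ _),
    ← Measure.volume_eq_prod]
  ext s hs
  rw [Measure.map_apply Complex.measurableEquivRealProd.symm.measurable hs,
    withDensity_apply _ (Complex.measurableEquivRealProd.symm.measurable hs),
    withDensity_apply _ hs,
    ← Complex.volume_preserving_equiv_real_prod.symm.setLIntegral_comp_preimage hs (by fun_prop)]
  refine lintegral_congr fun p => ?_
  rw [gaussianPDF, gaussianPDF, ← ENNReal.ofReal_mul (gaussianPDFReal_nonneg _ _ _)]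
  congr 1
  have hp : Real.sqrt (2 * Real.pi * ((1 / 2 : NNReal) : ℝ)) ^ 2 = Real.pi := by
    rw [Real.sq_sqrt (by positivity)]; push_cast; ring
  have h1 : gaussianPDFReal 0 (1 / 2) p.1 * gaussianPDFReal 0 (1 / 2) p.2 =
      (Real.sqrt (2 * Real.pi * ((1 / 2 : NNReal) : ℝ)) ^ 2)⁻¹ *
        (Real.exp (-(p.1 - 0) ^ 2 / (2 * ((1 / 2 : NNReal) : ℝ))) *
          Real.exp (-(p.2 - 0) ^ 2 / (2 * ((1 / 2 : NNReal) : ℝ)))) := by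
    simp only [gaussianPDFReal]; ring
  rw [h1, hp, ← Real.exp_add]
  congr 2
  simp [Complex.normSq_apply, Complex.measurableEquivRealProd]
  ring

theorem integrable_stdComplexGaussian_density :
    Integrable (fun z : ℂ => Real.pi⁻¹ * Real.exp (-Complex.normSq z)) := by
  have hm : Measurable (fun z : ℂ => Real.pi⁻¹ * Real.exp (-Complex.normSq z)) := by fun_prop
  refine ⟨hm.aestronglyMeasurable, ?_⟩
  rw [hasFiniteIntegral_iff_ofReal (ae_of_all _ fun z => by positivity)]
  have : (volume.withDensity fun z : ℂ =>
      ENNReal.ofReal (Real.pi⁻¹ * Real.exp (-Complex.normSq z))) Set.univ = 1 := by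
    rw [← stdComplexGaussian_eq_withDensity, measure_univ]
  rw [withDensity_apply _ MeasurableSet.univ, setLIntegral_univ] at this
  simp [this]

variable {ι : Type*} [Fintype ι]

variable (ι) in
/-- The law of a vector with i.i.d. `CN(0,1)` entries. -/
abbrev stdVec : Measure (ι → ℂ) := Measure.pi fun _ : ι => stdComplexGaussian

theorem quadForm_one [DecidableEq ι] (v : ι → ℂ) :
    quadForm 1 v = ∑ i, Complex.normSq (v i) := by
  simp [quadForm, dotProduct, Complex.normSq_apply]

theorem continuous_quadForm (A : Matrix ι ι ℂ) : Continuous (quadForm A) := by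
  unfold quadForm
  fun_prop

theorem measurable_quadForm (A : Matrix ι ι ℂ) : Measurable (quadForm A) :=
  (continuous_quadForm A).measurable

variable [DecidableEq ι]

theorem stdVec_eq_withDensity :
    stdVec ι = volume.withDensity fun w =>
      ENNReal.ofReal ((Real.pi ^ Fintype.card ι)⁻¹ * Real.exp (-quadForm 1 w)) := by
  rw [stdVec, stdComplexGaussian_eq_withDensity,
    pi_withDensity_ofReal (fun _ : ι => (volume : Measure ℂ))
      (fun _ z => Real.pi⁻¹ * Real.exp (-Complex.normSq z)) (fun _ _ => by positivity)
      fun _ => integrable_stdComplexGaussian_density, ← volume_pi]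
  congr 1
  ext w
  rw [Finset.prod_mul_distrib, ← Real.exp_sum, quadForm_one]
  simp [Finset.sum_neg_distrib]

theorem lintegral_gaussian_one :
    ∫⁻ w : ι → ℂ, ENNReal.ofReal ((Real.pi ^ Fintype.card ι)⁻¹ * Real.exp (-quadForm 1 w)) = 1 := by
  have : (stdVec ι) Set.univ = 1 := measure_univ
  rwa [stdVec_eq_withDensity, withDensity_apply _ MeasurableSet.univ, setLIntegral_univ] at this

theorem star_mulVec_dotProduct {m n : Type*} [Fintype m] [Fintype n] (M : Matrix m n ℂ) (u : n → ℂ)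
    (v : m → ℂ) : star (M *ᵥ u) ⬝ᵥ v = star u ⬝ᵥ (Mᴴ *ᵥ v) := by
  rw [star_mulVec, dotProduct_mulVec]

omit [DecidableEq ι] in
theorem quadForm_mulVec {κ : Type*} [Fintype κ] (A : Matrix κ κ ℂ) (R : Matrix κ ι ℂ) (w : ι → ℂ) :
    quadForm A (R *ᵥ w) = quadForm (Rᴴ * A * R) w := by
  rw [quadForm, quadForm, star_mulVec_dotProduct, mulVec_mulVec, mulVec_mulVec, Matrix.mul_assoc]

/-- The real determinant of a complex-linear map is the squared modulus of its complex determinant.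
-/
theorem lintegral_comp_mulVec (R : Matrix ι ι ℂ) (hR : R.det ≠ 0) {g : (ι → ℂ) → ℝ≥0∞}
    (hg : Measurable g) :
    ∫⁻ w, g (R *ᵥ w) = ENNReal.ofReal (Complex.normSq R.det)⁻¹ * ∫⁻ w, g w := by
  have hdet : LinearMap.det ((Matrix.toLin' R).restrictScalars ℝ) = Complex.normSq R.det := by
    rw [LinearMap.det_restrictScalars, LinearMap.det_toLin', Algebra.norm_complex_apply]
  have h0 : LinearMap.det ((Matrix.toLin' R).restrictScalars ℝ) ≠ 0 := by
    rw [hdet]; simpa using hR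
  have h := Measure.map_linearMap_addHaar_eq_smul_addHaar (volume : Measure (ι → ℂ)) h0
  rw [hdet, abs_of_nonneg (inv_nonneg.2 (Complex.normSq_nonneg _))] at h
  have hm : Measurable fun w : ι → ℂ => R *ᵥ w :=
    (Continuous.matrix_mulVec continuous_const continuous_id).measurable
  rw [← lintegral_map hg hm, ← smul_eq_mul, ← lintegral_smul_measure, ← h]
  rfl

/-- The Gaussian integral `π⁻ⁿ ∫ exp (-(w - c)† B (w - c)) dw = 1 / det B`. -/
theorem lintegral_gaussian {B : Matrix ι ι ℂ} (hB : B.PosDef) (c : ι → ℂ) :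
    ∫⁻ w : ι → ℂ, ENNReal.ofReal ((Real.pi ^ Fintype.card ι)⁻¹ * Real.exp (-quadForm B (w - c))) =
      ENNReal.ofReal (B.det.re)⁻¹ := by
  rw [lintegral_sub_right_eq_self (fun w : ι → ℂ =>
    ENNReal.ofReal ((Real.pi ^ Fintype.card ι)⁻¹ * Real.exp (-quadForm B w))) c]
  -- The substitution `w ↦ B^{1/2} w` reduces to `B = 1`. Its Jacobian `|det R|²` is `det B` because
  -- `R` is Hermitian with square `B`.
  set R := CFC.sqrt B with hRdef
  have hRh : Rᴴ = R := (posSemidef_sqrt B).1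
  have hRR : R * R = B := sqrt_mul_sqrt hB.posSemidef
  have hdet : B.det = R.det * R.det := by rw [← det_mul, hRR]
  have hdet0 : R.det ≠ 0 := fun h => hB.det_pos.ne' (by rw [hdet, h, zero_mul])
  have hconj : star R.det = R.det := by rw [← det_conjTranspose, hRh]
  have hn : Complex.normSq R.det = B.det.re := by
    have h2 := Complex.mul_conj R.det
    rw [starRingEnd_apply, hconj, ← hdet] at h2
    rw [h2, Complex.ofReal_re]
  have h := lintegral_comp_mulVec R hdet0 (g := fun w =>
    ENNReal.ofReal ((Real.pi ^ Fintype.card ι)⁻¹ * Real.exp (-quadForm 1 w)))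
    (by have := measurable_quadForm (1 : Matrix ι ι ℂ); fun_prop)
  rw [lintegral_gaussian_one, mul_one, hn] at h
  rw [← h]
  refine lintegral_congr fun w => ?_
  rw [quadForm_mulVec, hRh, Matrix.mul_one, hRR]

omit [DecidableEq ι] in
theorem quadForm_add_matrix (A B : Matrix ι ι ℂ) (v : ι → ℂ) :
    quadForm (A + B) v = quadForm A v + quadForm B v := by
  simp [quadForm, add_mulVec, dotProduct_add]

omit [DecidableEq ι] in
theorem quadForm_smul (t : ℝ) (A : Matrix ι ι ℂ) (v : ι → ℂ) :
    quadForm ((t : ℂ) • A) v = t * quadForm A v := by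
  simp [quadForm, smul_mulVec, dotProduct_smul]

omit [DecidableEq ι] in
theorem quadForm_nonneg {A : Matrix ι ι ℂ} (hA : A.PosSemidef) (v : ι → ℂ) : 0 ≤ quadForm A v :=
  (Complex.le_def.1 (hA.dotProduct_mulVec_nonneg v)).1

/-- The Laplace transform of a positive semidefinite quadratic form in i.i.d. `CN(0,1)` entries. -/
theorem lintegral_exp_neg_quadForm {N : Matrix ι ι ℂ} (hN : N.PosSemidef) {s : ℝ} (hs : 0 ≤ s) :
    ∫⁻ w, ENNReal.ofReal (Real.exp (-(s * quadForm N w))) ∂(stdVec ι) =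
      ENNReal.ofReal ((1 + (s : ℂ) • N).det.re)⁻¹ := by
  -- The factor `exp (-w†w)` of the density merges with the integrand into a Gaussian integral for
  -- `1 + sN`.
  have hB : (1 + (s : ℂ) • N).PosDef :=
    PosDef.one.add_posSemidef (hN.smul (by exact_mod_cast hs))
  have hN' := measurable_quadForm N
  have h1' := measurable_quadForm (1 : Matrix ι ι ℂ)
  rw [stdVec_eq_withDensity, lintegral_withDensity_eq_lintegral_mul _ (by fun_prop) (by fun_prop),
    ← lintegral_gaussian hB 0]
  refine lintegral_congr fun w => ?_
  rw [Pi.mul_apply, ← ENNReal.ofReal_mul (by positivity), mul_assoc, ← Real.exp_add, sub_zero,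
    quadForm_add_matrix, quadForm_smul, neg_add]

theorem integral_exp_neg_quadForm {N : Matrix ι ι ℂ} (hN : N.PosSemidef) {s : ℝ} (hs : 0 ≤ s) :
    ∫ w, Real.exp (-(s * quadForm N w)) ∂(stdVec ι) = ((1 + (s : ℂ) • N).det.re)⁻¹ := by
  have hB : (1 + (s : ℂ) • N).PosDef :=
    PosDef.one.add_posSemidef (hN.smul (by exact_mod_cast hs))
  have hN' := measurable_quadForm N
  rw [integral_eq_lintegral_of_nonneg_ae (ae_of_all _ fun w => by positivity)
    (by fun_prop), lintegral_exp_neg_quadForm hN hs, ENNReal.toReal_ofReal]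
  exact inv_nonneg.2 (Complex.le_def.1 hB.det_pos.le).1

end GaussianDensity

/-! ### Moments of standard complex Gaussian vectors -/

section Moments

theorem integrable_normSq_stdComplexGaussian :
    Integrable (fun z => Complex.normSq z) stdComplexGaussian ∧
    ∫ z, Complex.normSq z ∂stdComplexGaussian = 1 := by
  have h2 : MemLp (id : ℝ → ℝ) 2 (gaussianReal 0 (1 / 2)) := memLp_id_gaussianReal 2
  have hi : Integrable (fun x : ℝ => x ^ 2) (gaussianReal 0 (1 / 2)) := h2.integrable_sq
  have hv : ∫ x, x ^ 2 ∂(gaussianReal 0 (1 / 2)) = 1 / 2 := by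
    have := variance_id_gaussianReal (μ := 0) (v := 1 / 2)
    rw [variance_eq_integral (by fun_prop)] at this
    simpa using this
  have hn (p : ℝ × ℝ) : Complex.normSq (Complex.measurableEquivRealProd.symm p) =
      p.1 ^ 2 + p.2 ^ 2 := by
    simp [Complex.normSq_apply, Complex.measurableEquivRealProd]; ring
  have h1 : Integrable (fun p : ℝ × ℝ => p.1 ^ 2)
      ((gaussianReal 0 (1 / 2)).prod (gaussianReal 0 (1 / 2))) := hi.comp_fst _
  have h1' : Integrable (fun p : ℝ × ℝ => p.2 ^ 2)
      ((gaussianReal 0 (1 / 2)).prod (gaussianReal 0 (1 / 2))) := hi.comp_snd _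
  unfold stdComplexGaussian
  constructor
  · rw [integrable_map_equiv]
    exact (h1.add h1').congr (ae_of_all _ fun p => (hn p).symm)
  · rw [integral_map_equiv]
    simp_rw [hn]
    rw [integral_add h1 h1', integral_fun_fst (fun x : ℝ => x ^ 2),
      integral_fun_snd (fun x : ℝ => x ^ 2), hv]
    simp
    norm_num

theorem integrable_id_stdComplexGaussian : Integrable (fun z => z) stdComplexGaussian := by
  refine (MemLp.integrable (q := 2) (by norm_num) ?_)
  rw [memLp_two_iff_integrable_sq_norm (by fun_prop)]
  refine integrable_normSq_stdComplexGaussian.1.congr (ae_of_all _ fun z => ?_)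
  exact Complex.normSq_eq_norm_sq z

theorem stdComplexGaussian_map_neg : stdComplexGaussian.map (fun z => -z) = stdComplexGaussian := by
  have hm : Measurable fun z : ℂ => -z := measurable_neg
  rw [stdComplexGaussian_eq_withDensity]
  refine Measure.ext_of_lintegral _ fun f hf => ?_
  rw [lintegral_map hf hm, lintegral_withDensity_eq_lintegral_mul _ (by fun_prop) (by fun_prop),
    lintegral_withDensity_eq_lintegral_mul _ (by fun_prop) hf, ← lintegral_neg_eq_self]
  refine lintegral_congr fun z => ?_
  simp

theorem integral_id_stdComplexGaussian : ∫ z, z ∂stdComplexGaussian = 0 := by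
  have h : ∫ z, z ∂stdComplexGaussian = ∫ z, -z ∂stdComplexGaussian := by
    conv_lhs => rw [← stdComplexGaussian_map_neg]
    rw [integral_map (by fun_prop) (by fun_prop)]
  rw [integral_neg] at h
  exact self_eq_neg.1 h

variable {ι : Type*} [Fintype ι] [DecidableEq ι]

theorem integral_conj_mul_stdVec (i j : ι) :
    Integrable (fun w : ι → ℂ => star (w i) * w j) (stdVec ι) ∧
    ∫ w, star (w i) * w j ∂(stdVec ι) = if i = j then 1 else 0 := by
  by_cases hij : i = j
  · subst hij
    have he (w : ι → ℂ) : star (w i) * w i = ((Complex.normSq (w i) : ℝ) : ℂ) := by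
      rw [Complex.normSq_eq_conj_mul_self]; rfl
    have hi : Integrable (fun w : ι → ℂ => Complex.normSq (w i)) (stdVec ι) :=
      integrable_comp_eval (i := i) integrable_normSq_stdComplexGaussian.1
    simp_rw [he]
    refine ⟨hi.ofReal, ?_⟩
    have h1 : ∫ w : ι → ℂ, Complex.normSq (w i) ∂(stdVec ι) = 1 :=
      (integral_comp_eval (μ := fun _ : ι => stdComplexGaussian) (i := i)
        (f := fun z => Complex.normSq z)
        integrable_normSq_stdComplexGaussian.1.aestronglyMeasurable).trans
        integrable_normSq_stdComplexGaussian.2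
    rw [integral_complex_ofReal, h1]
    simp
  · have hind : iIndepFun (fun (i : ι) (w : ι → ℂ) => w i) (stdVec ι) :=
      iIndepFun_pi (X := fun _ z => z) fun _ => aemeasurable_id
    have hij' : IndepFun (fun w : ι → ℂ => star (w i)) (fun w : ι → ℂ => w j) (stdVec ι) :=
      (hind.indepFun hij).comp (φ := star) (ψ := id) continuous_star.measurable measurable_id
    have hI (k : ι) : Integrable (fun w : ι → ℂ => w k) (stdVec ι) :=
      integrable_comp_eval (i := k) (f := fun z => z) integrable_id_stdComplexGaussian
    have hIs : Integrable (fun w : ι → ℂ => star (w i)) (stdVec ι) := by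
      have hm : Measurable fun w : ι → ℂ => star (w i) :=
        continuous_star.measurable.comp (measurable_pi_apply i)
      refine (hI i).norm.mono' hm.aestronglyMeasurable (ae_of_all _ fun w => ?_)
      simp
    refine ⟨hij'.integrable_mul hIs (hI j), ?_⟩
    have := hij'.integral_fun_mul_eq_mul_integral hIs.aestronglyMeasurable (hI j).aestronglyMeasurable
    have h0 : ∫ w : ι → ℂ, w j ∂(stdVec ι) = 0 :=
      (integral_comp_eval (μ := fun _ : ι => stdComplexGaussian) (i := j) (f := fun z => z)
        aestronglyMeasurable_id).trans
        integral_id_stdComplexGaussian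
    rw [this, h0, if_neg hij, mul_zero]

/-- The covariance of a standard vector is the identity, so only the diagonal of `N` survives. -/
theorem integral_quadForm_stdVec (N : Matrix ι ι ℂ) :
    Integrable (quadForm N) (stdVec ι) ∧ ∫ w, quadForm N w ∂(stdVec ι) = N.trace.re := by
  have he (w : ι → ℂ) : star w ⬝ᵥ (N *ᵥ w) = ∑ i, ∑ j, N i j * (star (w i) * w j) := by
    simp only [dotProduct, mulVec, Finset.mul_sum, Pi.star_apply]
    refine Finset.sum_congr rfl fun i _ => Finset.sum_congr rfl fun j _ => by ring
  have h1 (i j : ι) : Integrable (fun w : ι → ℂ => N i j * (star (w i) * w j)) (stdVec ι) :=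
    (integral_conj_mul_stdVec i j).1.const_mul _
  have h2 : Integrable (fun w => star w ⬝ᵥ (N *ᵥ w)) (stdVec ι) := by
    simp_rw [he]
    exact integrable_finsetSum _ fun i _ => integrable_finsetSum _ fun j _ => h1 i j
  refine ⟨h2.re, ?_⟩
  have h3 : ∫ w, star w ⬝ᵥ (N *ᵥ w) ∂(stdVec ι) = N.trace := by
    simp_rw [he]
    rw [integral_finsetSum _ fun i _ => integrable_finsetSum _ fun j _ => h1 i j]
    refine Finset.sum_congr rfl fun i _ => ?_
    rw [integral_finsetSum _ fun j _ => h1 i j]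
    simp_rw [integral_const_mul, (integral_conj_mul_stdVec i _).2]
    simp
  rw [← h3]
  exact integral_re h2

/-- Expectation of a quadratic form in `G W + Z` for independent standard vectors `W` and `Z`. -/
theorem integral_quadForm_affine {κ : Type*} [Fintype κ] [DecidableEq κ] (G : Matrix κ ι ℂ)
    (Q : Matrix κ κ ℂ) :
    Integrable (fun p : (ι → ℂ) × (κ → ℂ) => quadForm Q (G *ᵥ p.1 + p.2))
      ((stdVec ι).prod (stdVec κ)) ∧
    ∫ p, quadForm Q (G *ᵥ p.1 + p.2) ∂((stdVec ι).prod (stdVec κ)) =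
      (Q * (1 + G * Gᴴ)).trace.re := by
  -- The pair `(W, Z)` is one standard vector on `ι ⊕ κ`, and `G W + Z` is its image under the block
  -- row `D = [G 1]`.
  have hmp := measurePreserving_sumPiEquivProdPi (X := fun _ : ι ⊕ κ => ℂ)
    fun _ => stdComplexGaussian
  set D : Matrix κ (ι ⊕ κ) ℂ := fromCols G 1 with hD
  have he (v : ι ⊕ κ → ℂ) :
      quadForm Q (G *ᵥ (MeasurableEquiv.sumPiEquivProdPi (fun _ : ι ⊕ κ => ℂ) v).1 +
        (MeasurableEquiv.sumPiEquivProdPi (fun _ : ι ⊕ κ => ℂ) v).2) =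
      quadForm (Dᴴ * Q * D) v := by
    rw [← quadForm_mulVec, hD, fromCols_mulVec, one_mulVec]
    rfl
  obtain ⟨hi, hv⟩ := integral_quadForm_stdVec (Dᴴ * Q * D)
  have ht : (Dᴴ * Q * D).trace = (Q * (1 + G * Gᴴ)).trace := by
    rw [Matrix.mul_assoc, trace_mul_comm, Matrix.mul_assoc, hD,
      conjTranspose_fromCols_eq_fromRows_conjTranspose, fromCols_mul_fromRows]
    simp [add_comm]
  constructor
  · rw [← hmp.integrable_comp_emb (MeasurableEquiv.measurableEmbedding _)]
    exact hi.congr (ae_of_all _ fun v => (he v).symm)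
  · rw [← hmp.integral_comp (MeasurableEquiv.measurableEmbedding _), ← ht, ← hv]
    exact integral_congr_ae (ae_of_all _ he)

end Moments

/-! ### Mutual information of the Gaussian channel and bounds on the rate -/

section MutualInformation

variable {ι κ : Type*} [Fintype ι] [DecidableEq ι] [Fintype κ] [DecidableEq κ]

omit [DecidableEq κ] in
theorem posDef_one_add_conjTranspose_mul_self (G : Matrix κ ι ℂ) : (1 + Gᴴ * G).PosDef :=
  PosDef.one.add_posSemidef (posSemidef_conjTranspose_mul_self G)

/-- The inverse output covariance `(1 + G G†)⁻¹`, in Woodbury form. -/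
def invOutputCov (G : Matrix κ ι ℂ) : Matrix κ κ ℂ := 1 - G * (1 + Gᴴ * G)⁻¹ * Gᴴ

/-- Rests on the push-through identity `G†(1 + GG†) = (1 + G†G)G†`. -/
theorem invOutputCov_mul (G : Matrix κ ι ℂ) : invOutputCov G * (1 + G * Gᴴ) = 1 := by
  have hu : IsUnit (1 + Gᴴ * G).det :=
    (Matrix.isUnit_iff_isUnit_det _).1 (posDef_one_add_conjTranspose_mul_self G).isUnit
  have h : G * (1 + Gᴴ * G)⁻¹ * Gᴴ * (1 + G * Gᴴ) = G * Gᴴ := by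
    have : Gᴴ * (1 + G * Gᴴ) = (1 + Gᴴ * G) * Gᴴ := by
      rw [Matrix.mul_add, Matrix.add_mul, Matrix.mul_one, Matrix.one_mul, Matrix.mul_assoc]
    rw [Matrix.mul_assoc, this, ← Matrix.mul_assoc, Matrix.mul_assoc G, nonsing_inv_mul _ hu,
      Matrix.mul_one]
  rw [invOutputCov, Matrix.sub_mul, h, Matrix.one_mul, add_sub_cancel_right]

/-- Completing the square in `w`: the left side is the exponent of the joint density of `W` and `G W
+ Z`. On the right, `w` occurs only in a shifted Gaussian, which can be integrated out. -/
theorem quadForm_complete_square (G : Matrix κ ι ℂ) (y : κ → ℂ) (w : ι → ℂ) :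
    quadForm 1 w + quadForm 1 (y - G *ᵥ w) =
      quadForm (1 + Gᴴ * G) (w - (1 + Gᴴ * G)⁻¹ *ᵥ (Gᴴ *ᵥ y)) + quadForm (invOutputCov G) y := by
  set B := 1 + Gᴴ * G with hB
  have hBd : B.PosDef := posDef_one_add_conjTranspose_mul_self G
  have hBh : Bᴴ = B := hBd.1
  have hu : IsUnit B.det := (Matrix.isUnit_iff_isUnit_det _).1 hBd.isUnit
  set c := B⁻¹ *ᵥ (Gᴴ *ᵥ y) with hc
  have hBc : B *ᵥ c = Gᴴ *ᵥ y := by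
    rw [hc, mulVec_mulVec, mul_nonsing_inv _ hu, one_mulVec]
  have h1 : star w ⬝ᵥ (B *ᵥ w) = star w ⬝ᵥ w + star (G *ᵥ w) ⬝ᵥ (G *ᵥ w) := by
    rw [hB, add_mulVec, dotProduct_add, one_mulVec, star_mulVec_dotProduct, mulVec_mulVec]
  have h2 : star c ⬝ᵥ (B *ᵥ w) = star y ⬝ᵥ (G *ᵥ w) := by
    conv_lhs => rw [← hBh, ← star_mulVec_dotProduct, hBc, star_mulVec_dotProduct,
      conjTranspose_conjTranspose]
  have h3 : star w ⬝ᵥ (B *ᵥ c) = star (G *ᵥ w) ⬝ᵥ y := by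
    rw [hBc, star_mulVec_dotProduct]
  have h4 : star c ⬝ᵥ (B *ᵥ c) = star y ⬝ᵥ ((G * B⁻¹ * Gᴴ) *ᵥ y) := by
    conv_lhs => rw [← hBh, ← star_mulVec_dotProduct, hBc, star_mulVec_dotProduct,
      conjTranspose_conjTranspose, hc, mulVec_mulVec, mulVec_mulVec]
  simp only [quadForm, one_mulVec, invOutputCov, ← hB, sub_mulVec, mulVec_sub, star_sub,
    sub_dotProduct, dotProduct_sub, h1, h2, h3, h4]
  simp only [Complex.add_re, Complex.sub_re]
  ring

/-- Density of the standard complex Gaussian vector. -/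
def gaussDensity (y : κ → ℂ) : ℝ := (Real.pi ^ Fintype.card κ)⁻¹ * Real.exp (-quadForm 1 y)

theorem measurable_gaussDensity : Measurable (gaussDensity (κ := κ)) := by
  have := measurable_quadForm (1 : Matrix κ κ ℂ)
  unfold gaussDensity
  fun_prop

/-- Density of `G W + Z` for independent standard complex Gaussian vectors `W` and `Z`. -/
def outputDensity (G : Matrix κ ι ℂ) (y : κ → ℂ) : ℝ :=
  (1 + Gᴴ * G).det.re⁻¹ * ((Real.pi ^ Fintype.card κ)⁻¹ * Real.exp (-quadForm (invOutputCov G) y))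

theorem det_re_pos {B : Matrix ι ι ℂ} (hB : B.PosDef) : 0 < B.det.re :=
  (Complex.lt_def.1 hB.det_pos).1

theorem outputDensity_pos (G : Matrix κ ι ℂ) (y : κ → ℂ) : 0 < outputDensity G y := by
  have := det_re_pos (posDef_one_add_conjTranspose_mul_self G)
  unfold outputDensity
  positivity

theorem measurable_outputDensity (G : Matrix κ ι ℂ) : Measurable (outputDensity G) := by
  have := measurable_quadForm (invOutputCov G)
  unfold outputDensity
  fun_prop

omit [DecidableEq ι] [DecidableEq κ] in
theorem measurable_mulVec (R : Matrix κ ι ℂ) : Measurable fun w : ι → ℂ => R *ᵥ w :=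
  (Continuous.matrix_mulVec continuous_const continuous_id).measurable

theorem lintegral_gaussDensity_sub_mulVec (G : Matrix κ ι ℂ) (y : κ → ℂ) :
    ∫⁻ w, ENNReal.ofReal (gaussDensity (y - G *ᵥ w)) ∂(stdVec ι) =
      ENNReal.ofReal (outputDensity G y) := by
  have hB := posDef_one_add_conjTranspose_mul_self G
  have h1 := measurable_quadForm (1 : Matrix ι ι ℂ)
  have h2 : Measurable fun w : ι → ℂ => gaussDensity (y - G *ᵥ w) :=
    measurable_gaussDensity.comp (measurable_const.sub (measurable_mulVec G))
  have h3 := measurable_quadForm (1 + Gᴴ * G)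
  rw [stdVec_eq_withDensity, lintegral_withDensity_eq_lintegral_mul _ (by fun_prop) (by fun_prop),
    outputDensity, ENNReal.ofReal_mul (inv_nonneg.2 (det_re_pos hB).le),
    ← lintegral_gaussian hB ((1 + Gᴴ * G)⁻¹ *ᵥ (Gᴴ *ᵥ y)), ← lintegral_mul_const _ (by fun_prop)]
  refine lintegral_congr fun w => ?_
  rw [Pi.mul_apply, gaussDensity, ← ENNReal.ofReal_mul (by positivity),
    ← ENNReal.ofReal_mul (by positivity), mul_mul_mul_comm, ← Real.exp_add, ← neg_add,
    quadForm_complete_square, neg_add, Real.exp_add, mul_mul_mul_comm]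

theorem stdVec_eq_withDensity_gaussDensity :
    stdVec κ = volume.withDensity fun y => ENNReal.ofReal (gaussDensity y) :=
  stdVec_eq_withDensity

theorem lintegral_stdVec_add (a : κ → ℂ) {f : (κ → ℂ) → ℝ≥0∞} (hf : Measurable f) :
    ∫⁻ z, f (a + z) ∂(stdVec κ) = ∫⁻ y, ENNReal.ofReal (gaussDensity (y - a)) * f y := by
  have h1 := measurable_gaussDensity (κ := κ)
  rw [stdVec_eq_withDensity_gaussDensity,
    lintegral_withDensity_eq_lintegral_mul _ (by fun_prop) (by fun_prop),
    ← lintegral_sub_right_eq_self _ a]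
  refine lintegral_congr fun y => ?_
  simp

/-- The joint law of `(A W, G W + Z)` for independent standard vectors `W` and `Z`. -/
def jointLaw (A : Matrix ι ι ℂ) (h : Matrix κ ι ℂ) : Measure ((ι → ℂ) × (κ → ℂ)) :=
  ((stdVec ι).prod (stdVec κ)).map fun p => (A *ᵥ p.1, h *ᵥ (A *ᵥ p.1) + p.2)

omit [DecidableEq ι] [DecidableEq κ] in
theorem measurable_jointMap (A : Matrix ι ι ℂ) (h : Matrix κ ι ℂ) :
    Measurable fun p : (ι → ℂ) × (κ → ℂ) => (A *ᵥ p.1, h *ᵥ (A *ᵥ p.1) + p.2) := by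
  have h1 : Measurable fun p : (ι → ℂ) × (κ → ℂ) => A *ᵥ p.1 :=
    (measurable_mulVec A).comp measurable_fst
  exact h1.prodMk (((measurable_mulVec h).comp h1).add measurable_snd)

instance (A : Matrix ι ι ℂ) (h : Matrix κ ι ℂ) : IsProbabilityMeasure (jointLaw A h) :=
  Measure.isProbabilityMeasure_map (measurable_jointMap A h).aemeasurable

/-- The input `A W` has no density when `A` is singular, so densities are used in the output
variable only and the input is integrated through `W`. -/
theorem lintegral_jointLaw (A : Matrix ι ι ℂ) (h : Matrix κ ι ℂ)
    {f : (ι → ℂ) × (κ → ℂ) → ℝ≥0∞} (hf : Measurable f) :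
    ∫⁻ q, f q ∂(jointLaw A h) = ∫⁻ w, (∫⁻ y,
      ENNReal.ofReal (gaussDensity (y - h *ᵥ (A *ᵥ w))) * f (A *ᵥ w, y)) ∂(stdVec ι) := by
  have hfm : Measurable fun p : (ι → ℂ) × (κ → ℂ) => f (A *ᵥ p.1, h *ᵥ (A *ᵥ p.1) + p.2) :=
    hf.comp (measurable_jointMap A h)
  rw [jointLaw, lintegral_map hf (measurable_jointMap A h),
    lintegral_prod _ hfm.aemeasurable]
  refine lintegral_congr fun w => ?_
  exact lintegral_stdVec_add (h *ᵥ (A *ᵥ w)) (f := fun y => f (A *ᵥ w, y)) (by fun_prop)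

theorem fst_jointLaw (A : Matrix ι ι ℂ) (h : Matrix κ ι ℂ) :
    (jointLaw A h).fst = (stdVec ι).map fun w => A *ᵥ w := by
  rw [Measure.fst, jointLaw, Measure.map_map measurable_fst (measurable_jointMap A h)]
  conv_rhs => rw [← Measure.fst_prod (μ := stdVec ι) (ν := stdVec κ), Measure.fst,
    Measure.map_map (measurable_mulVec A) measurable_fst]
  rfl

theorem snd_jointLaw (A : Matrix ι ι ℂ) (h : Matrix κ ι ℂ) :
    (jointLaw A h).snd = volume.withDensity fun y => ENNReal.ofReal (outputDensity (h * A) y) := by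
  have hg := measurable_outputDensity (h * A)
  refine Measure.ext_of_lintegral _ fun f hf => ?_
  have hm : Measurable fun p : (ι → ℂ) × (κ → ℂ) =>
      ENNReal.ofReal (gaussDensity (p.2 - h *ᵥ (A *ᵥ p.1))) :=
    (measurable_gaussDensity.comp (measurable_snd.sub ((measurable_mulVec h).comp
      ((measurable_mulVec A).comp measurable_fst)))).ennreal_ofReal
  have hm2 : Measurable fun p : (ι → ℂ) × (κ → ℂ) =>
      ENNReal.ofReal (gaussDensity (p.2 - h *ᵥ (A *ᵥ p.1))) * f p.2 :=
    hm.mul (hf.comp measurable_snd)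
  have hmy (y : κ → ℂ) : Measurable fun w : ι → ℂ =>
      ENNReal.ofReal (gaussDensity (y - h *ᵥ (A *ᵥ w))) :=
    (measurable_gaussDensity.comp (measurable_const.sub ((measurable_mulVec h).comp
      (measurable_mulVec A)))).ennreal_ofReal
  have hint (y : κ → ℂ) :
      ∫⁻ w, ENNReal.ofReal (gaussDensity (y - h *ᵥ (A *ᵥ w))) * f y ∂(stdVec ι) =
        ENNReal.ofReal (outputDensity (h * A) y) * f y := by
    rw [lintegral_mul_const _ (hmy y), ← lintegral_gaussDensity_sub_mulVec]
    simp_rw [mulVec_mulVec]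
  have hswap := lintegral_lintegral_swap (μ := stdVec ι) (ν := (volume : Measure (κ → ℂ)))
    (f := fun w y => ENNReal.ofReal (gaussDensity (y - h *ᵥ (A *ᵥ w))) * f y) hm2.aemeasurable
  have hjoint := lintegral_jointLaw A h (hf.comp measurable_snd)
  simp only [Function.comp_apply] at hjoint
  rw [Measure.snd, lintegral_map hf measurable_snd, hjoint, hswap,
    lintegral_withDensity_eq_lintegral_mul _ hg.ennreal_ofReal hf]
  exact lintegral_congr hint

/-- The density of the joint law with respect to the product of its marginals. -/
def jointDensity (A : Matrix ι ι ℂ) (h : Matrix κ ι ℂ) (q : (ι → ℂ) × (κ → ℂ)) : ℝ :=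
  gaussDensity (q.2 - h *ᵥ q.1) / outputDensity (h * A) q.2

theorem measurable_jointDensity (A : Matrix ι ι ℂ) (h : Matrix κ ι ℂ) :
    Measurable (jointDensity A h) :=
  (measurable_gaussDensity.comp (measurable_snd.sub ((measurable_mulVec h).comp
    measurable_fst))).div ((measurable_outputDensity _).comp measurable_snd)

/-- The conditional density of the output given the input, divided by the output density, is a
density relative to the product of the marginals even for a singular input law. -/
theorem jointLaw_eq_withDensity (A : Matrix ι ι ℂ) (h : Matrix κ ι ℂ) :
    jointLaw A h = ((jointLaw A h).fst.prod (jointLaw A h).snd).withDensity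
      fun q => ENNReal.ofReal (jointDensity A h q) := by
  have hg := measurable_outputDensity (h * A)
  have hd := measurable_jointDensity A h
  have hfin : SFinite (volume.withDensity fun y => ENNReal.ofReal (outputDensity (h * A) y)) := by
    rw [← snd_jointLaw]; infer_instance
  refine Measure.ext_of_lintegral _ fun f hf => ?_
  rw [lintegral_withDensity_eq_lintegral_mul _ (by fun_prop) hf, lintegral_jointLaw A h hf,
    lintegral_prod _ (by fun_prop), fst_jointLaw, snd_jointLaw,
    lintegral_map _ (measurable_mulVec A)]
  · refine lintegral_congr fun w => ?_
    rw [lintegral_withDensity_eq_lintegral_mul _ (by fun_prop) (by fun_prop)]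
    refine lintegral_congr fun y => ?_
    have hp := outputDensity_pos (h * A) y
    rw [Pi.mul_apply, Pi.mul_apply, ← mul_assoc, ← ENNReal.ofReal_mul hp.le, jointDensity,
      mul_div_cancel₀ _ hp.ne']
  · exact Measurable.lintegral_prod_right' (f := ((fun q => ENNReal.ofReal (jointDensity A h q)) * f))
      (by fun_prop)

theorem log_jointDensity (A : Matrix ι ι ℂ) (h : Matrix κ ι ℂ) (q : (ι → ℂ) × (κ → ℂ)) :
    Real.log (jointDensity A h q) = Real.log (1 + (h * A)ᴴ * (h * A)).det.re +
      quadForm (invOutputCov (h * A)) q.2 - quadForm 1 (q.2 - h *ᵥ q.1) := by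
  have hd := det_re_pos (posDef_one_add_conjTranspose_mul_self (h * A))
  have hpi : ((Real.pi ^ Fintype.card κ)⁻¹ : ℝ) ≠ 0 := by positivity
  have hinv := Real.log_inv (1 + (h * A)ᴴ * (h * A) : Matrix ι ι ℂ).det.re
  rw [jointDensity, gaussDensity, outputDensity, Real.log_div (by positivity) (by positivity),
    Real.log_mul hpi (Real.exp_ne_zero _), Real.log_mul (by positivity) (by positivity),
    Real.log_mul hpi (Real.exp_ne_zero _), Real.log_exp, Real.log_exp, hinv]
  ring

/-- The output measured in its own inverse covariance and the noise measured in the identity both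
have mean square `card κ`. They cancel and leave the log-determinant. -/
theorem integral_log_jointDensity (A : Matrix ι ι ℂ) (h : Matrix κ ι ℂ) :
    Integrable (fun q => Real.log (jointDensity A h q)) (jointLaw A h) ∧
    ∫ q, Real.log (jointDensity A h q) ∂(jointLaw A h) =
      Real.log (1 + (h * A)ᴴ * (h * A)).det.re := by
  have hm : Measurable fun q => Real.log (jointDensity A h q) := (measurable_jointDensity A h).log
  obtain ⟨hi, hv⟩ := integral_quadForm_affine (h * A) (invOutputCov (h * A))
  rw [invOutputCov_mul] at hv
  obtain ⟨hi1, hv1⟩ := integral_quadForm_stdVec (1 : Matrix κ κ ℂ)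
  have he (p : (ι → ℂ) × (κ → ℂ)) :
      Real.log (jointDensity A h (A *ᵥ p.1, h *ᵥ (A *ᵥ p.1) + p.2)) =
        Real.log (1 + (h * A)ᴴ * (h * A)).det.re +
          quadForm (invOutputCov (h * A)) ((h * A) *ᵥ p.1 + p.2) - quadForm 1 p.2 := by
    rw [log_jointDensity, add_sub_cancel_left, mulVec_mulVec]
  have hi1' : Integrable (fun p : (ι → ℂ) × (κ → ℂ) => quadForm 1 p.2)
    ((stdVec ι).prod (stdVec κ)) := hi1.comp_snd _
  have hic : Integrable (fun p : (ι → ℂ) × (κ → ℂ) => Real.log (1 + (h * A)ᴴ * (h * A)).det.re +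
      quadForm (invOutputCov (h * A)) ((h * A) *ᵥ p.1 + p.2)) ((stdVec ι).prod (stdVec κ)) :=
    (integrable_const _).add hi
  unfold jointLaw
  constructor
  · rw [integrable_map_measure hm.aestronglyMeasurable (measurable_jointMap A h).aemeasurable]
    exact (hic.sub hi1').congr (ae_of_all _ fun p => (he p).symm)
  · rw [integral_map (measurable_jointMap A h).aemeasurable hm.aestronglyMeasurable]
    simp_rw [he]
    rw [integral_sub hic hi1', integral_add (integrable_const _) hi, hv,
      integral_fun_snd (fun z : κ → ℂ => quadForm 1 z), hv1]
    simp

theorem mutualInfo_jointLaw (A : Matrix ι ι ℂ) (h : Matrix κ ι ℂ) :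
    mutualInfo (jointLaw A h) = ENNReal.ofReal (Real.log (1 + (h * A)ᴴ * (h * A)).det.re) := by
  set μ := jointLaw A h with hμ
  set ν := μ.fst.prod μ.snd with hν
  have hw : μ = ν.withDensity fun q => ENNReal.ofReal (jointDensity A h q) :=
    jointLaw_eq_withDensity A h
  have hac : μ ≪ ν := by rw [hw]; exact withDensity_absolutelyContinuous _ _
  obtain ⟨hi, hv⟩ := integral_log_jointDensity A h
  have hrn : μ.rnDeriv ν =ᵐ[μ] fun q => ENNReal.ofReal (jointDensity A h q) := by
    refine hac.ae_le ?_
    have := Measure.rnDeriv_withDensity ν (measurable_jointDensity A h).ennreal_ofReal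
    rwa [← hw] at this
  have hllr : llr μ ν =ᵐ[μ] fun q => Real.log (jointDensity A h q) := by
    filter_upwards [hrn] with q hq
    rw [llr, hq, ENNReal.toReal_ofReal]
    exact div_nonneg (by unfold gaussDensity; positivity) (outputDensity_pos _ _).le
  rw [mutualInfo, InformationTheory.klDiv_of_ac_of_integrable hac (hi.congr hllr.symm),
    integral_congr_ae hllr, hv]
  -- The mass correction in `klDiv` vanishes since both measures are probability measures.
  simp

theorem inputOutputLaw_eq_jointLaw {nt nr : ℕ} (C : Matrix (Fin nt) (Fin nt) ℂ)
    (h : Matrix (Fin nr) (Fin nt) ℂ) : inputOutputLaw C h = jointLaw (CFC.sqrt C) h := by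
  have h1 : complexGaussian (1 : Matrix (Fin nr) (Fin nr) ℂ) = stdVec (Fin nr) := by
    simp [complexGaussian, CFC.sqrt_one]
  have h2 : ((complexGaussian C).prod (stdVec (Fin nr))) =
      ((stdVec (Fin nt)).prod (stdVec (Fin nr))).map (Prod.map (CFC.sqrt C *ᵥ ·) id) := by
    rw [← Measure.map_prod_map _ _ (measurable_mulVec _) measurable_id, Measure.map_id]
    rfl
  rw [inputOutputLaw, h1, h2, Measure.map_map _ ((measurable_mulVec _).prodMap measurable_id)]
  · rfl
  · exact measurable_fst.prodMk (((measurable_mulVec h).comp measurable_fst).add measurable_snd)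

/-- The log-det formula for the mutual information of a Gaussian channel. -/
theorem channelRate_eq {nt nr : ℕ} (S : Matrix (Fin nt) (Fin nt) ℂ) (γ : ℝ)
    (h : Matrix (Fin nr) (Fin nt) ℂ) :
    channelRate S γ h = ENNReal.ofReal (Real.log (1 + (h * CFC.sqrt ((γ : ℂ) • S))ᴴ *
      (h * CFC.sqrt ((γ : ℂ) • S))).det.re) := by
  rw [channelRate, inputOutputLaw_eq_jointLaw, mutualInfo_jointLaw]

/-- The received power gain `tr (h S h†)`, as a quadratic form in `vec h†`. -/
def gain {nt nr : ℕ} (S : Matrix (Fin nt) (Fin nt) ℂ) (h : Matrix (Fin nr) (Fin nt) ℂ) : ℝ :=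
  quadForm ((1 : Matrix (Fin nr) (Fin nr) ℂ) ⊗ₖ S) (vec hᴴ)

/-- The blocks of `vec hᴴ` are the conjugated rows of `h`, and `1 ⊗ₖ S` acts on each block
separately. -/
theorem gain_eq_trace {nt nr : ℕ} (S : Matrix (Fin nt) (Fin nt) ℂ)
    (h : Matrix (Fin nr) (Fin nt) ℂ) : gain S h = (h * S * hᴴ).trace.re := by
  rw [gain, quadForm]
  congr 1
  simp only [dotProduct, mulVec, trace, diag, Matrix.mul_apply, Fintype.sum_prod_type, vec,
    kroneckerMap_apply, Pi.star_apply, conjTranspose_apply, star_star, one_apply]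
  refine Finset.sum_congr rfl fun r _ => ?_
  simp only [ite_mul, one_mul, zero_mul]
  have (t : Fin nt) : ∑ x, ∑ y, (if r = x then S t y * star (h x y) else 0) =
      ∑ y, S t y * star (h r y) := by
    rw [Finset.sum_comm]
    simp
  simp_rw [this, Finset.mul_sum, Finset.sum_mul]
  rw [Finset.sum_comm]
  simp_rw [mul_assoc]

theorem trace_gram {nt nr : ℕ} {S : Matrix (Fin nt) (Fin nt) ℂ} (hS : S.PosSemidef) {γ : ℝ}
    (hγ : 0 ≤ γ) (h : Matrix (Fin nr) (Fin nt) ℂ) :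
    ((h * CFC.sqrt ((γ : ℂ) • S))ᴴ * (h * CFC.sqrt ((γ : ℂ) • S))).trace.re = γ * gain S h := by
  have hs : ((γ : ℂ) • S).PosSemidef := hS.smul (by exact_mod_cast hγ)
  have hh : (CFC.sqrt ((γ : ℂ) • S))ᴴ = CFC.sqrt ((γ : ℂ) • S) := (posSemidef_sqrt _).1
  rw [trace_mul_comm, conjTranspose_mul, hh, Matrix.mul_assoc, ← Matrix.mul_assoc (CFC.sqrt _),
    sqrt_mul_sqrt hs, Matrix.smul_mul, Matrix.mul_smul, trace_smul, gain_eq_trace, Matrix.mul_assoc]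
  simp

theorem gain_nonneg {nt nr : ℕ} {S : Matrix (Fin nt) (Fin nt) ℂ} (hS : S.PosSemidef)
    (h : Matrix (Fin nr) (Fin nt) ℂ) : 0 ≤ gain S h :=
  quadForm_nonneg (PosSemidef.one.kronecker hS) _

theorem channelRate_le {nt nr : ℕ} {S : Matrix (Fin nt) (Fin nt) ℂ} (hS : S.PosSemidef) {γ : ℝ}
    (hγ : 0 ≤ γ) (h : Matrix (Fin nr) (Fin nt) ℂ) :
    channelRate S γ h ≤ ENNReal.ofReal (γ * gain S h) := by
  rw [channelRate_eq, ← trace_gram hS hγ]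
  exact ENNReal.ofReal_le_ofReal
    (log_det_one_add_le_trace (posSemidef_conjTranspose_mul_self _))

theorem le_channelRate {nt nr : ℕ} {S : Matrix (Fin nt) (Fin nt) ℂ} (hS : S.PosSemidef) {γ : ℝ}
    (hγ : 0 ≤ γ) (h : Matrix (Fin nr) (Fin nt) ℂ) :
    ENNReal.ofReal (Real.log (1 + γ * gain S h)) ≤ channelRate S γ h := by
  rw [channelRate_eq, ← trace_gram hS hγ]
  refine ENNReal.ofReal_le_ofReal (Real.log_le_log ?_
    (one_add_trace_le_det (posSemidef_conjTranspose_mul_self _)))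
  rw [trace_gram hS hγ]
  have := mul_nonneg hγ (gain_nonneg hS h)
  linarith

end MutualInformation

/-! ### Large deviations of the empirical mean of the gains -/

section LargeDeviations

variable {ι : Type*} [Fintype ι] {Ω : Type*} [MeasurableSpace Ω]

/-- `logDet ν s = ∑ log (1 + s ν i)` is `log det (1 + s N)` when the `ν i` are the eigenvalues
of `N`. -/
def logDet (ν : ι → ℝ) (s : ℝ) : ℝ := ∑ i, Real.log (1 + s * ν i)

/-- The derivative of `logDet ν`. -/
def logDetDeriv (ν : ι → ℝ) (s : ℝ) : ℝ := ∑ i, ν i / (1 + s * ν i)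

/-- An i.i.d. sequence of nonnegative random variables whose Laplace transform is
`s ↦ ∏ (1 + s ν i)⁻¹` and whose mean is `∑ ν i`. -/
structure IsGainSequence (P : Measure Ω) (X : ℕ → Ω → ℝ) (ν : ι → ℝ) : Prop where
  aemeasurable (k : ℕ) : AEMeasurable (X k) P
  indep : iIndepFun X P
  ident (k : ℕ) : IdentDistrib (X k) (X 0) P P
  nonneg (k : ℕ) (ω : Ω) : 0 ≤ X k ω
  eig_nonneg (i : ι) : 0 ≤ ν i
  mgf_eq (s : ℝ) : 0 ≤ s → mgf (X 0) P (-s) = Real.exp (-logDet ν s)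
  integrable : Integrable (X 0) P
  integral_eq : P[X 0] = ∑ i, ν i

theorem logDetDeriv_zero (ν : ι → ℝ) : logDetDeriv ν 0 = ∑ i, ν i := by simp [logDetDeriv]

section Eig

variable {ν : ι → ℝ} (hν : ∀ i, 0 ≤ ν i)

include hν

theorem hasDerivAt_logDet {s : ℝ} (hs : 0 ≤ s) : HasDerivAt (logDet ν) (logDetDeriv ν s) s := by
  unfold logDet logDetDeriv
  refine HasDerivAt.fun_sum fun i _ => ?_
  have hp : 1 + s * ν i ≠ 0 := by have := mul_nonneg hs (hν i); positivity
  have h1 : HasDerivAt (fun s => 1 + s * ν i) (ν i) s := by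
    simpa using ((hasDerivAt_id s).mul_const (ν i)).const_add 1
  exact h1.log hp

theorem continuousOn_logDetDeriv : ContinuousOn (logDetDeriv ν) (Set.Ici 0) := by
  unfold logDetDeriv
  refine continuousOn_finsetSum _ fun i _ => ContinuousOn.div (by fun_prop) (by fun_prop) fun s hs => ?_
  have := mul_nonneg (Set.mem_Ici.1 hs) (hν i)
  positivity

/-- Termwise this is `1 - 1/x ≤ log x` at `x = 1 + s ν i`. -/
theorem mul_logDetDeriv_le_logDet {s : ℝ} (hs : 0 ≤ s) : s * logDetDeriv ν s ≤ logDet ν s := by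
  unfold logDet logDetDeriv
  rw [Finset.mul_sum]
  refine Finset.sum_le_sum fun i _ => ?_
  have h0 := mul_nonneg hs (hν i)
  have hp : 0 < 1 + s * ν i := by positivity
  have := Real.one_sub_inv_le_log_of_pos hp
  refine le_trans (le_of_eq ?_) this
  field_simp
  ring

theorem exists_logDetDeriv_le {ε : ℝ} (hε : 0 < ε) : ∃ s, 0 < s ∧ logDetDeriv ν s ≤ ε := by
  -- Each term is at most `1/s`, so `s ≥ card ι / ε` suffices. The extra `1` keeps `s` positive when
  -- `ι` is empty.
  refine ⟨(Fintype.card ι + 1) / ε, by positivity, ?_⟩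
  set s : ℝ := (Fintype.card ι + 1) / ε with hs
  have hs0 : 0 < s := by positivity
  have h1 : logDetDeriv ν s ≤ ∑ _i : ι, s⁻¹ := by
    refine Finset.sum_le_sum fun i _ => ?_
    have h0 := mul_nonneg hs0.le (hν i)
    rw [div_le_iff₀ (by positivity), mul_add, ← mul_assoc, inv_mul_cancel₀ hs0.ne']
    have : 0 < s⁻¹ := by positivity
    linarith
  refine h1.trans ?_
  rw [Finset.sum_const, nsmul_eq_mul, Finset.card_univ, hs, inv_div, mul_div_assoc',
    div_le_iff₀ (by positivity)]
  nlinarith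

/-- Below the mean, tilts with mean slightly less than `a` exist and cost little. -/
theorem exists_tilt {a ε : ℝ} (ha : 0 < a) (haν : a ≤ ∑ i, ν i) (hε : 0 < ε) :
    ∃ s, 0 < s ∧ logDetDeriv ν s < a ∧ s * (a - logDetDeriv ν s) < ε := by
  obtain ⟨s₀, hs₀, hle⟩ := exists_logDetDeriv_le hν (half_pos ha)
  -- `b` is the tilted mean to be attained. Being at least `a / 2` puts it in the range of
  -- `logDetDeriv ν` on `[0, s₀]`, and being within `ε / (2 s₀)` of `a` bounds the cost, as `s ≤
  -- s₀`.
  set b := max (a / 2) (a - ε / (2 * s₀)) with hb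
  have hba : b < a := max_lt (by linarith) (by have : 0 < ε / (2 * s₀) := by positivity
                                               linarith)
  have hcont : ContinuousOn (logDetDeriv ν) (Set.Icc 0 s₀) :=
    (continuousOn_logDetDeriv hν).mono fun x hx => hx.1
  have hmem : b ∈ Set.Icc (logDetDeriv ν s₀) (logDetDeriv ν 0) :=
    ⟨hle.trans (le_max_left _ _), by rw [logDetDeriv_zero]; linarith⟩
  obtain ⟨s, ⟨hs0, hs1⟩, hsb⟩ := intermediate_value_Icc' hs₀.le hcont hmem
  have hs0' : 0 < s := by
    rcases hs0.eq_or_lt with h | h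
    · exfalso
      rw [← h, logDetDeriv_zero] at hsb
      linarith
    · exact h
  refine ⟨s, hs0', by linarith, ?_⟩
  rw [hsb]
  have h1 : a - b ≤ ε / (2 * s₀) := by linarith [le_max_right (a / 2) (a - ε / (2 * s₀))]
  calc s * (a - b) ≤ s₀ * (ε / (2 * s₀)) := by gcongr
    _ = ε / 2 := by field_simp
    _ < ε := by linarith

/-- Above the threshold the Chernoff exponent is positive. -/
theorem exists_pos_exponent {a : ℝ} (ha : a < ∑ i, ν i) : ∃ s, 0 < s ∧ 0 < -s * a + logDet ν s := by
  have h : Tendsto (logDetDeriv ν) (𝓝[Set.Ici 0] 0) (𝓝 (∑ i, ν i)) := by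
    have := continuousOn_logDetDeriv hν 0 Set.self_mem_Ici
    rwa [ContinuousWithinAt, logDetDeriv_zero] at this
  have h' : Tendsto (logDetDeriv ν) (𝓝[>] 0) (𝓝 (∑ i, ν i)) :=
    h.mono_left (nhdsWithin_mono _ Set.Ioi_subset_Ici_self)
  obtain ⟨s, hs, hs0⟩ := ((h'.eventually_const_lt ha).and self_mem_nhdsWithin).exists
  refine ⟨s, hs0, ?_⟩
  have := mul_logDetDeriv_le_logDet hν (le_of_lt hs0)
  have h2 : s * a < s * logDetDeriv ν s := mul_lt_mul_of_pos_left hs hs0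
  linarith

end Eig

variable {P : Measure Ω} [IsProbabilityMeasure P] {X : ℕ → Ω → ℝ} {ν : ι → ℝ}

namespace IsGainSequence

variable (hX : IsGainSequence P X ν)

include hX

/-- Replacing the gain by its logarithmic lower bound costs nothing in the limit: `n log (1 + x/n) →
x` with `n = K/ρ`, and the exponentials are bounded by `1`. -/
theorem tendsto_mgf_log {ρ : ℝ} (hρ : 0 < ρ) {s : ℝ} (hs : 0 ≤ s) :
    Tendsto (fun K : ℕ => mgf (fun ω => K / ρ * Real.log (1 + ρ / K * X 0 ω)) P (-s)) atTop
      (𝓝 (Real.exp (-logDet ν s))) := by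
  rw [← hX.mgf_eq s hs]
  have hm := hX.aemeasurable 0
  refine tendsto_integral_of_dominated_convergence (fun _ => 1) (fun K => ?_)
    (integrable_const _) (fun K => ae_of_all _ fun ω => ?_) (ae_of_all _ fun ω => ?_)
  · exact (by fun_prop : AEMeasurable _ P).aestronglyMeasurable
  · have h0 : 0 ≤ Real.log (1 + ρ / K * X 0 ω) := by
      refine Real.log_nonneg ?_
      have := hX.nonneg 0 ω
      have : 0 ≤ ρ / K * X 0 ω := by positivity
      linarith
    rw [Real.norm_eq_abs, Real.abs_exp, Real.exp_le_one_iff, neg_mul, neg_nonpos]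
    positivity
  · have h := (Real.tendsto_mul_log_one_add_div_atTop (X 0 ω)).comp
      (tendsto_natCast_atTop_atTop.atTop_div_const hρ)
    refine (Real.continuous_exp.tendsto _).comp ((h.const_mul (-s)).congr fun K => ?_)
    simp only [Function.comp_apply]
    congr 4
    rw [div_div_eq_mul_div]
    ring

/-- Chernoff bound for the rate. -/
theorem measure_log_le {ρ : ℝ} (hρ : 0 < ρ) {s a c : ℝ} (hs : 0 ≤ s)
    (hc : c < -s * a + logDet ν s) :
    ∀ᶠ K : ℕ in atTop, P {ω | ∑ k ∈ Finset.range K, Real.log (1 + ρ / K * X k ω) ≤ ρ * a} ≤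
      ENNReal.ofReal (Real.exp (-(K * c))) := by
  -- The strict slack in `c` absorbs the error between the Laplace transform at finite `K` and its
  -- limit.
  have hlt : Real.exp (-logDet ν s) < Real.exp (-c - s * a) := Real.exp_lt_exp.2 (by linarith)
  filter_upwards [(hX.tendsto_mgf_log hρ hs).eventually_lt_const hlt, eventually_gt_atTop 0]
    with K hK hK0
  have hK0' : (0 : ℝ) < K := by exact_mod_cast hK0
  set Y : ℕ → Ω → ℝ := fun k ω => K / ρ * Real.log (1 + ρ / K * X k ω) with hY
  have hφ : Measurable fun x : ℝ => K / ρ * Real.log (1 + ρ / K * x) := by fun_prop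
  have hYm (k : ℕ) : AEMeasurable (Y k) P := hφ.comp_aemeasurable (hX.aemeasurable k)
  have hYi : iIndepFun Y P := hX.indep.comp (fun _ x => K / ρ * Real.log (1 + ρ / K * x)) fun _ => hφ
  have hYd (k : ℕ) : IdentDistrib (Y k) (Y 0) P P := (hX.ident k).comp hφ
  have hmgf : mgf (∑ k ∈ Finset.range K, Y k) P (-s) = mgf (Y 0) P (-s) ^ K := by
    rw [mgf_sum_of_identDistrib₀ hYm hYi
      (fun i _ j _ => (hYd i).trans (hYd j).symm) (Finset.mem_range.2 hK0), Finset.card_range]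
  have hnn (k : ℕ) (ω : Ω) : 0 ≤ Y k ω := by
    have := hX.nonneg k ω
    have h0 : 0 ≤ ρ / K * X k ω := by positivity
    exact mul_nonneg (by positivity) (Real.log_nonneg (by linarith))
  have hsm : AEMeasurable (∑ k ∈ Finset.range K, Y k) P := Finset.aemeasurable_sum _ fun k _ => hYm k
  have hint : Integrable (fun ω => Real.exp (-s * (∑ k ∈ Finset.range K, Y k) ω)) P := by
    refine Integrable.mono' (integrable_const 1)
      (by fun_prop : AEMeasurable _ P).aestronglyMeasurable (ae_of_all _ fun ω => ?_)
    rw [Real.norm_eq_abs, Real.abs_exp, Real.exp_le_one_iff, neg_mul, neg_nonpos]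
    refine mul_nonneg hs ?_
    rw [Finset.sum_apply]
    exact Finset.sum_nonneg fun k _ => hnn k ω
  have hch := measure_le_le_exp_mul_mgf (μ := P) (K * a) (neg_nonpos.2 hs) hint
  have hset : {ω | ∑ k ∈ Finset.range K, Real.log (1 + ρ / K * X k ω) ≤ ρ * a} =
      {ω | (∑ k ∈ Finset.range K, Y k) ω ≤ K * a} := by
    ext ω
    simp only [Set.mem_ofPred_eq, Finset.sum_apply, hY, ← Finset.mul_sum]
    rw [div_mul_eq_mul_div, div_le_iff₀ hρ, mul_assoc, mul_le_mul_iff_right₀ hK0', mul_comm a]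
  rw [hset, ← ofReal_measureReal]
  refine ENNReal.ofReal_le_ofReal (hch.trans ?_)
  rw [hmgf]
  calc Real.exp (-(-s) * (K * a)) * mgf (Y 0) P (-s) ^ K
      ≤ Real.exp (-(-s) * (K * a)) * Real.exp (-c - s * a) ^ K := by
        gcongr
        exact mgf_nonneg
    _ = Real.exp (-(K * c)) := by
        rw [← Real.exp_nat_mul, ← Real.exp_add]
        congr 1
        ring

theorem integrable_exp_mul_sum (K : ℕ) {t : ℝ} (ht : t ≤ 0) :
    Integrable (fun ω => Real.exp (t * (∑ k ∈ Finset.range K, X k) ω)) P := by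
  have hsm : AEMeasurable (∑ k ∈ Finset.range K, X k) P :=
    Finset.aemeasurable_sum _ fun k _ => hX.aemeasurable k
  refine Integrable.mono' (integrable_const 1)
    (by fun_prop : AEMeasurable _ P).aestronglyMeasurable (ae_of_all _ fun ω => ?_)
  rw [Real.norm_eq_abs, Real.abs_exp, Real.exp_le_one_iff]
  refine mul_nonpos_of_nonpos_of_nonneg ht ?_
  rw [Finset.sum_apply]
  exact Finset.sum_nonneg fun k _ => hX.nonneg k ω

omit [IsProbabilityMeasure P] in
theorem cgf_sum_eq (K : ℕ) {t : ℝ} (ht : t ≤ 0) :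
    cgf (∑ k ∈ Finset.range K, X k) P t = K * -logDet ν (-t) := by
  have h0 : mgf (X 0) P t = Real.exp (-logDet ν (-t)) := by
    rw [← hX.mgf_eq (-t) (by linarith), neg_neg]
  rw [cgf, hX.indep.mgf_sum₀ hX.aemeasurable,
    Finset.prod_congr rfl fun k _ => mgf_congr_of_identDistrib (X k) (X 0) (hX.ident k) t,
    Finset.prod_const, Finset.card_range, h0, ← Real.exp_nat_mul, Real.log_exp]

/-- Interior membership is what identifies the mean and variance under tilting with derivatives of
the cumulant generating function. It is available because nonnegative variables have exponential
moments at all `t ≤ 0`. -/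
theorem mem_interior_integrableExpSet (K : ℕ) {t : ℝ} (ht : t < 0) :
    t ∈ interior (integrableExpSet (∑ k ∈ Finset.range K, X k) P) := by
  refine mem_interior.2 ⟨Set.Iio 0, fun u hu => ?_, isOpen_Iio, ht⟩
  exact hX.integrable_exp_mul_sum K (le_of_lt hu)

omit [IsProbabilityMeasure P] in
theorem cgf_sum_eventuallyEq (K : ℕ) {t : ℝ} (ht : t < 0) :
    cgf (∑ k ∈ Finset.range K, X k) P =ᶠ[𝓝 t] fun t => K * -logDet ν (-t) := by
  filter_upwards [Iio_mem_nhds ht] with u hu using hX.cgf_sum_eq K (le_of_lt hu)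

/-- Under the tilted measure the normalized sum concentrates at `logDetDeriv ν s`. -/
theorem tilted_concentration {s δ : ℝ} (hs : 0 < s) (hδ : 0 < δ) :
    ∀ᶠ K : ℕ in atTop, P.tilted (fun ω => -s * (∑ k ∈ Finset.range K, X k) ω)
      {ω | K * δ ≤ |(∑ k ∈ Finset.range K, X k) ω - K * logDetDeriv ν s|} ≤ 1 / 2 := by
  -- `v` is the tilted variance per summand, so Chebyshev gives `K v / (K δ)² = v / (δ² K)`.
  set v := iteratedDeriv 2 (fun t => -logDet ν (-t)) (-s) with hv
  have hlim : Tendsto (fun K : ℕ => v / δ ^ 2 / (K : ℝ)) atTop (𝓝 0) :=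
    tendsto_const_div_atTop_nhds_zero_nat _
  filter_upwards [hlim.eventually_lt_const (show (0 : ℝ) < 1 / 2 by norm_num),
    eventually_gt_atTop 0] with K hK hK0
  have hK0' : (0 : ℝ) < K := by exact_mod_cast hK0
  set S := ∑ k ∈ Finset.range K, X k with hS
  have hs' : -s < 0 := by linarith
  have hmem := hX.mem_interior_integrableExpSet K hs'
  have hev := hX.cgf_sum_eventuallyEq K hs'
  have hder : HasDerivAt (fun t => -logDet ν (-t)) (logDetDeriv ν s) (-s) := by
    have h1 : HasDerivAt (logDet ν) (logDetDeriv ν s) (-(-s)) := by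
      rw [neg_neg]; exact hasDerivAt_logDet hX.eig_nonneg hs.le
    have h2 := (h1.comp (-s) (hasDerivAt_neg (-s))).neg
    rw [mul_neg_one, neg_neg] at h2
    exact h2
  have hmean : (P.tilted (fun ω => -s * S ω))[S] = K * logDetDeriv ν s := by
    rw [integral_tilted_mul_self hmem, hev.deriv_eq]
    exact (hder.const_mul (K : ℝ)).deriv
  have hvar : Var[S; P.tilted (fun ω => -s * S ω)] = K * v := by
    rw [variance_tilted_mul hmem, hev.iteratedDeriv_eq, hv]
    exact iteratedDeriv_const_mul_field (K : ℝ) (fun t => -logDet ν (-t))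
  have : IsProbabilityMeasure (P.tilted (fun ω => -s * S ω)) :=
    isProbabilityMeasure_tilted (hX.integrable_exp_mul_sum K hs'.le)
  have hch := meas_ge_le_variance_div_sq (memLp_tilted_mul hmem 2) (mul_pos hK0' hδ)
  rw [hmean, hvar] at hch
  refine hch.trans ?_
  have : (1 / 2 : ℝ≥0∞) = ENNReal.ofReal (1 / 2) := by
    rw [ENNReal.ofReal_div_of_pos (by norm_num)]; simp
  rw [this]
  refine ENNReal.ofReal_le_ofReal (le_trans (le_of_eq ?_) hK.le)
  field_simp

/-- Cramér's lower bound below the mean. -/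
theorem le_measure_sum_le {a I ε : ℝ} (ha : 0 < a) (haν : a ≤ ∑ i, ν i)
    (hI : ∀ s, 0 ≤ s → -s * a + logDet ν s ≤ I) (hε : 0 < ε) :
    ∀ᶠ K : ℕ in atTop, ENNReal.ofReal (Real.exp (-(K * (I + ε)))) ≤
      P {ω | ∑ k ∈ Finset.range K, X k ω ≤ K * a} := by
  obtain ⟨s, hs, hma, hcost⟩ := exists_tilt hX.eig_nonneg ha haν (half_pos hε)
  set m := logDetDeriv ν s with hm
  -- The window `|S - K m| < K δ` must stay below `K a`. The slack `ε` is spent as `ε/2` on the gap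
  -- `a - m`, `ε/4` on the window and `ε/4` on the probability `1/2` of the window.
  obtain ⟨δ, hδ, hδa, hδε⟩ : ∃ δ, 0 < δ ∧ δ ≤ a - m ∧ s * δ ≤ ε / 4 := by
    refine ⟨min (a - m) (ε / (4 * s)), lt_min (by linarith) (by positivity), min_le_left _ _, ?_⟩
    calc s * min (a - m) (ε / (4 * s)) ≤ s * (ε / (4 * s)) := by gcongr; exact min_le_right _ _
      _ = ε / 4 := by field_simp
  have hhalf : Tendsto (fun K : ℕ => Real.exp (-(K * (ε / 4)))) atTop (𝓝 0) :=
    Real.tendsto_exp_neg_atTop_nhds_zero.comp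
      (tendsto_natCast_atTop_atTop.atTop_mul_const (by positivity))
  filter_upwards [hX.tilted_concentration hs hδ,
    hhalf.eventually_lt_const (show (0 : ℝ) < 1 / 2 by norm_num)] with K hK hK2
  set S := ∑ k ∈ Finset.range K, X k with hS
  have hs' : -s < 0 := by linarith
  set Q := P.tilted (fun ω => -s * S ω) with hQ
  have hint := hX.integrable_exp_mul_sum K hs'.le
  have : IsProbabilityMeasure Q := isProbabilityMeasure_tilted hint
  set A := {ω | |S ω - K * m| < K * δ} with hA
  have hAc : {ω | K * δ ≤ |S ω - K * m|} = Aᶜ := by ext ω; simp [hA]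
  rw [hAc] at hK
  have hQA : 1 / 2 ≤ Q A := by
    have h1 : (1 : ℝ≥0∞) ≤ Q A + Q Aᶜ := by
      rw [← measure_univ (μ := Q), ← Set.union_compl_self A]
      exact measure_union_le _ _
    by_contra! hlt
    have : Q A + Q Aᶜ < 1 / 2 + 1 / 2 := ENNReal.add_lt_add_of_lt_of_le (by finiteness) hlt hK
    rw [ENNReal.add_halves] at this
    exact absurd h1 this.not_ge
  have hSm : AEMeasurable S P := Finset.aemeasurable_sum _ fun k _ => hX.aemeasurable k
  have hAm : NullMeasurableSet A P :=
    nullMeasurableSet_lt (by fun_prop) aemeasurable_const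
  have hAmem {ω : Ω} (hω : ω ∈ A) : |S ω - K * m| < K * δ := by
    simpa only [hA, Set.mem_ofPred_eq] using hω
  -- On the window, `E` bounds the logarithm of the tilted density with respect to `P`, since `S ≥ K
  -- (m - δ)` there.
  set E := -s * (K * (m - δ)) - K * -logDet ν s with hE
  have hQA2 : Q A ≤ ENNReal.ofReal (Real.exp E) * P A := by
    rw [hQ, tilted_mul_apply_cgf A hint, hX.cgf_sum_eq K hs'.le, neg_neg, ← setLIntegral_const]
    refine lintegral_mono_ae ((ae_restrict_iff'₀ hAm).2 (ae_of_all _ fun ω hω => ?_))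
    refine ENNReal.ofReal_le_ofReal (Real.exp_le_exp.2 ?_)
    have h1 : K * (m - δ) ≤ S ω := by
      have := (abs_lt.1 (hAmem hω)).1
      linarith
    rw [hE]
    nlinarith
  have hAsub : A ⊆ {ω | ∑ k ∈ Finset.range K, X k ω ≤ K * a} := fun ω hω => by
    have h1 := (abs_lt.1 (hAmem hω)).2
    have h2 : (K : ℝ) * δ ≤ K * (a - m) := by gcongr
    rw [hS, Finset.sum_apply] at h1
    simp only [Set.mem_ofPred_eq]
    linarith
  refine le_trans ?_ (measure_mono hAsub)
  have hEinv : ENNReal.ofReal (Real.exp (-E)) * ENNReal.ofReal (Real.exp E) = 1 := by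
    rw [← ENNReal.ofReal_mul (Real.exp_pos _).le, ← Real.exp_add]; simp
  calc ENNReal.ofReal (Real.exp (-(K * (I + ε))))
      ≤ ENNReal.ofReal (Real.exp (-E) * (1 / 2)) := by
        refine ENNReal.ofReal_le_ofReal ?_
        have h1 : -(K * (I + ε)) ≤ -E + -(K * (ε / 4)) := by
          have h2 := hI s hs.le
          have h3 : E = K * (-s * a + logDet ν s + s * (a - m) + s * δ) := by rw [hE]; ring
          have h4 : (K : ℝ) * (-s * a + logDet ν s + s * (a - m) + s * δ) ≤
              K * (I + ε / 2 + ε / 4) := by gcongr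
          linarith
        calc Real.exp (-(K * (I + ε))) ≤ Real.exp (-E + -(K * (ε / 4))) := Real.exp_le_exp.2 h1
          _ = Real.exp (-E) * Real.exp (-(K * (ε / 4))) := Real.exp_add _ _
          _ ≤ Real.exp (-E) * (1 / 2) := by gcongr
    _ = ENNReal.ofReal (Real.exp (-E)) * (1 / 2) := by
        rw [ENNReal.ofReal_mul (Real.exp_pos _).le, ENNReal.ofReal_div_of_pos (by norm_num)]
        simp
    _ ≤ ENNReal.ofReal (Real.exp (-E)) * (ENNReal.ofReal (Real.exp E) * P A) := by
        gcongr
        exact hQA.trans hQA2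
    _ = P A := by rw [← mul_assoc, hEinv, one_mul]

/-- Weak law of large numbers, upper tail. -/
theorem tendsto_measure_le_sum {c : ℝ} (hc : ∑ i, ν i < c) :
    Tendsto (fun K : ℕ => P {ω | K * c ≤ ∑ k ∈ Finset.range K, X k ω}) atTop (𝓝 0) := by
  have hae := strong_law_ae_real X hX.integrable
    (fun i j hij => hX.indep.indepFun hij) hX.ident
  rw [hX.integral_eq] at hae
  have hm := tendstoInMeasure_of_tendsto_ae (fun K => by
    have (k : ℕ) := hX.aemeasurable k
    exact (by fun_prop : AEMeasurable (fun ω => (∑ i ∈ Finset.range K, X i ω) / (K : ℝ))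
      P).aestronglyMeasurable) hae
  have := hm (ENNReal.ofReal (c - ∑ i, ν i)) (by simpa using hc)
  refine tendsto_of_tendsto_of_tendsto_of_le_of_le' tendsto_const_nhds this
    (Eventually.of_forall fun _ => zero_le) ?_
  filter_upwards [eventually_gt_atTop 0] with K hK0
  have hK0' : (0 : ℝ) < K := by exact_mod_cast hK0
  refine measure_mono fun ω hω => ?_
  simp only [Set.mem_ofPred_eq] at hω ⊢
  rw [edist_dist, Real.dist_eq]
  refine ENNReal.ofReal_le_ofReal (le_trans ?_ (le_abs_self _))
  have : c ≤ (∑ k ∈ Finset.range K, X k ω) / K := by rw [le_div_iff₀ hK0']; linarith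
  linarith

end IsGainSequence

end LargeDeviations

/-! ### Outage probability, minimum energy and exponent in terms of the gains -/

section Outage

variable {nt nr : ℕ} {Ω : Type*} [MeasurableSpace Ω]

omit [MeasurableSpace Ω] in
theorem le_totalRate {S : Matrix (Fin nt) (Fin nt) ℂ} (hS : S.PosSemidef)
    (H : ℕ → Ω → Matrix (Fin nr) (Fin nt) ℂ) {ρ : ℝ} (hρ : 0 < ρ) (K : ℕ) (ω : Ω) :
    ENNReal.ofReal (∑ k ∈ Finset.range K, Real.log (1 + ρ / K * gain S (H k ω))) ≤
      totalRate S H ρ K ω := by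
  rw [ENNReal.ofReal_sum_of_nonneg]
  · exact Finset.sum_le_sum fun k _ => le_channelRate hS (by positivity) _
  · intro k _
    have := gain_nonneg hS (H k ω)
    have : 0 ≤ ρ / K * gain S (H k ω) := by positivity
    exact Real.log_nonneg (by linarith)

omit [MeasurableSpace Ω] in
theorem totalRate_le {S : Matrix (Fin nt) (Fin nt) ℂ} (hS : S.PosSemidef)
    (H : ℕ → Ω → Matrix (Fin nr) (Fin nt) ℂ) {ρ : ℝ} (hρ : 0 < ρ) (K : ℕ) (ω : Ω) :
    totalRate S H ρ K ω ≤
      ENNReal.ofReal (ρ / K * ∑ k ∈ Finset.range K, gain S (H k ω)) := by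
  rw [Finset.mul_sum, ENNReal.ofReal_sum_of_nonneg]
  · exact Finset.sum_le_sum fun k _ => channelRate_le hS (by positivity) _
  · intro k _
    have := gain_nonneg hS (H k ω)
    positivity

variable {ι : Type*} [Fintype ι] {P : Measure Ω} [IsProbabilityMeasure P]
  {S : Matrix (Fin nt) (Fin nt) ℂ} {H : ℕ → Ω → Matrix (Fin nr) (Fin nt) ℂ} {ρ : ℝ} {ν : ι → ℝ}

section

variable (hS : S.PosSemidef) (hρ : 0 < ρ)

include hS hρ

omit [IsProbabilityMeasure P] in
-- The target rate `ρ/η` is written `ρ a` with `a = 1/η`, so that `a` compares directly with the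
-- mean gain.
theorem outageProb_le_measure_log {a : ℝ} (ha : 0 ≤ a) (K : ℕ) :
    outageProb P S H ρ K (ρ * a) ≤
      P {ω | ∑ k ∈ Finset.range K, Real.log (1 + ρ / K * gain S (H k ω)) ≤ ρ * a} := by
  refine measure_mono fun ω hω => ?_
  exact (ENNReal.ofReal_le_ofReal_iff (by positivity)).1 ((le_totalRate hS H hρ K ω).trans hω)

omit [IsProbabilityMeasure P] in
theorem measure_sum_le_outageProb (a : ℝ) {K : ℕ} (hK : 0 < K) :
    P {ω | ∑ k ∈ Finset.range K, gain S (H k ω) ≤ K * a} ≤ outageProb P S H ρ K (ρ * a) := by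
  have hK' : (0 : ℝ) < K := by exact_mod_cast hK
  refine measure_mono fun ω hω => (totalRate_le hS H hρ K ω).trans (ENNReal.ofReal_le_ofReal ?_)
  have hω' : ∑ k ∈ Finset.range K, gain S (H k ω) ≤ K * a := hω
  calc ρ / K * ∑ k ∈ Finset.range K, gain S (H k ω) ≤ ρ / K * (K * a) := by gcongr
    _ = ρ * a := by field_simp

variable (hX : IsGainSequence P (fun k ω => gain S (H k ω)) ν)

include hX

theorem outageProb_le_exp {s a c : ℝ} (ha : 0 ≤ a) (hs : 0 ≤ s) (hc : c < -s * a + logDet ν s) :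
    ∀ᶠ K : ℕ in atTop, outageProb P S H ρ K (ρ * a) ≤ ENNReal.ofReal (Real.exp (-(K * c))) := by
  filter_upwards [hX.measure_log_le hρ hs hc] with K hK
  exact (outageProb_le_measure_log hS hρ ha K).trans hK

theorem exp_le_outageProb {a I ε : ℝ} (ha : 0 < a) (haν : a ≤ ∑ i, ν i)
    (hI : ∀ s, 0 ≤ s → -s * a + logDet ν s ≤ I) (hε : 0 < ε) :
    ∀ᶠ K : ℕ in atTop, ENNReal.ofReal (Real.exp (-(K * (I + ε)))) ≤
      outageProb P S H ρ K (ρ * a) := by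
  filter_upwards [hX.le_measure_sum_le ha haν hI hε, eventually_gt_atTop 0] with K hK hK0
  exact hK.trans (measure_sum_le_outageProb hS hρ a hK0)

theorem tendsto_outageProb_zero {a : ℝ} (ha : 0 ≤ a) (haν : a < ∑ i, ν i) :
    Tendsto (fun K : ℕ => outageProb P S H ρ K (ρ * a)) atTop (𝓝 0) := by
  obtain ⟨s, hs, hpos⟩ := exists_pos_exponent hX.eig_nonneg haν
  have hexp : Tendsto (fun K : ℕ => ENNReal.ofReal
      (Real.exp (-(K * ((-s * a + logDet ν s) / 2))))) atTop (𝓝 0) := by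
    rw [← ENNReal.ofReal_zero]
    refine (ENNReal.continuous_ofReal.tendsto 0).comp (Real.tendsto_exp_neg_atTop_nhds_zero.comp
      (tendsto_natCast_atTop_atTop.atTop_mul_const (half_pos hpos)))
  exact tendsto_of_tendsto_of_tendsto_of_le_of_le' tendsto_const_nhds hexp
    (Eventually.of_forall fun _ => zero_le)
    (outageProb_le_exp hS hρ hX ha hs.le (half_lt_self hpos))

/-- The events `K a ≤ ∑ X k` and `∑ X k ≤ K a` cover the space. The first has vanishing probability
and the second forces outage. -/
theorem not_tendsto_outageProb_zero {a : ℝ} (haν : ∑ i, ν i < a) :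
    ¬ Tendsto (fun K : ℕ => outageProb P S H ρ K (ρ * a)) atTop (𝓝 0) := by
  intro h
  have h1 := (hX.tendsto_measure_le_sum haν).add h
  rw [add_zero] at h1
  have h2 : (1 : ℝ≥0∞) ≤ 0 := by
    refine ge_of_tendsto h1 ?_
    filter_upwards [eventually_gt_atTop 0] with K hK0
    refine le_trans ?_ (add_le_add_right (measure_sum_le_outageProb hS hρ a hK0) _)
    rw [← measure_univ (μ := P)]
    refine (measure_mono fun ω _ => ?_).trans (measure_union_le _ _)
    exact le_total (K * a) (∑ k ∈ Finset.range K, gain S (H k ω))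
  simp at h2

/-- Outage vanishes for `1/η` below the mean gain and does not for `1/η` above it. The boundary
value does not affect the infimum. -/
theorem minEnergyPerNat_eq :
    minEnergyPerNat P S H ρ = (ENNReal.ofReal (∑ i, ν i))⁻¹ := by
  have hτ : 0 ≤ ∑ i, ν i := Finset.sum_nonneg fun i _ => hX.eig_nonneg i
  refine le_antisymm ?_ ?_
  · rcases hτ.eq_or_lt with h0 | h0
    · simp [← h0]
    refine le_of_forall_gt fun b hb => ?_
    rw [← ENNReal.ofReal_inv_of_pos h0] at hb
    obtain ⟨η, hη1, hη2⟩ := ENNReal.lt_iff_exists_nnreal_btwn.1 hb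
    have hη : (∑ i, ν i)⁻¹ < η := by
      rwa [← ENNReal.ofReal_coe_nnreal, ENNReal.ofReal_lt_ofReal_iff_of_nonneg (by positivity)] at hη1
    have hη0 : (0 : ℝ) < η := lt_trans (by positivity) hη
    refine lt_of_le_of_lt (sInf_le ⟨η, hη0, ENNReal.ofReal_coe_nnreal.symm, ?_⟩) hη2
    simp_rw [div_eq_mul_inv]
    exact tendsto_outageProb_zero hS hρ hX (by positivity) (inv_lt_of_inv_lt₀ h0 hη)
  · refine le_sInf ?_
    rintro _ ⟨η, hη, rfl, ht⟩
    by_contra! hlt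
    simp_rw [div_eq_mul_inv] at ht
    refine not_tendsto_outageProb_zero hS hρ hX ?_ ht
    rw [ENNReal.lt_inv_iff_lt_inv, ← ENNReal.ofReal_inv_of_pos hη,
      ENNReal.ofReal_lt_ofReal_iff (by positivity)] at hlt
    exact hlt

theorem tendstoInMeasure_energyPerNat :
    TendstoInMeasure P (fun (K : ℕ) ω => ENNReal.ofReal ρ / totalRate S H ρ K ω) atTop
      (fun _ => (ENNReal.ofReal (∑ i, ν i))⁻¹) := by
  have hτ : 0 ≤ ∑ i, ν i := Finset.sum_nonneg fun i _ => hX.eig_nonneg i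
  intro ε hε
  rcases hτ.eq_or_lt with h0 | h0
  -- Mean zero forces every gain, hence the rate, to vanish almost surely, and then the energy per
  -- nat is exactly `⊤`.
  · have hint := hX.integral_eq
    rw [← h0, integral_eq_zero_iff_of_nonneg (fun ω => hX.nonneg 0 ω) hX.integrable] at hint
    have hzero (k : ℕ) : ∀ᵐ ω ∂P, gain S (H k ω) = 0 :=
      (hX.ident k).symm.ae_snd (p := fun x => x = 0) (measurableSet_singleton 0) hint
    have hae : ∀ᵐ ω ∂P, ∀ k, gain S (H k ω) = 0 := ae_all_iff.2 hzero
    refine tendsto_const_nhds.congr fun K => Eq.symm ?_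
    refine measure_mono_null (t := {ω | ¬ ∀ k, gain S (H k ω) = 0}) (fun ω hω hg => ?_) hae
    have hR : totalRate S H ρ K ω = 0 := by
      have := totalRate_le hS H hρ K ω
      simpa [hg] using this
    have hω' : ε ≤ edist (ENNReal.ofReal ρ / totalRate S H ρ K ω) (ENNReal.ofReal (∑ i, ν i))⁻¹ := hω
    rw [hR, ENNReal.div_zero (by simpa using hρ), ← h0, ENNReal.ofReal_zero, ENNReal.inv_zero] at hω'
    have : edist (⊤ : ℝ≥0∞) ⊤ = 0 := rfl
    rw [this] at hω'
    exact hε.not_ge hω'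
  · set τ := ∑ i, ν i with hτdef
    -- Outside two events of vanishing probability, `t = R/ρ` lies within `d` of `τ`. Continuity of
    -- inversion at `τ > 0` turns this into closeness of `ρ/R` to `1/τ`.
    have hcont : Tendsto (fun t : ℝ => edist (t⁻¹.toNNReal) (τ⁻¹.toNNReal)) (𝓝 τ) (𝓝 0) := by
      rw [← edist_self τ⁻¹.toNNReal]
      exact ((continuous_real_toNNReal.tendsto _).comp (tendsto_inv₀ h0.ne')).edist tendsto_const_nhds
    obtain ⟨δ, hδ, hball⟩ := Metric.eventually_nhds_iff.1
      ((hcont.eventually_lt_const hε).and (eventually_gt_nhds h0))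
    obtain ⟨d, hd, hdδ⟩ : ∃ d, 0 < d ∧ d < min δ τ := exists_between (lt_min hδ h0)
    have hdτ : d < τ := hdδ.trans_le (min_le_right _ _)
    have hdδ' : d < δ := hdδ.trans_le (min_le_left _ _)
    have h1 := (tendsto_outageProb_zero hS hρ hX (a := τ - d) (by linarith) (by linarith)).add
      (hX.tendsto_measure_le_sum (c := τ + d) (by linarith))
    rw [add_zero] at h1
    refine tendsto_of_tendsto_of_tendsto_of_le_of_le' tendsto_const_nhds h1
      (Eventually.of_forall fun _ => zero_le) ?_
    filter_upwards [eventually_gt_atTop 0] with K hK0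
    have hK' : (0 : ℝ) < K := by exact_mod_cast hK0
    refine (measure_mono fun ω hω => ?_).trans (measure_union_le _ _)
    by_contra hnot
    simp only [Set.mem_union, Set.mem_ofPred_eq, not_or, not_le] at hnot
    obtain ⟨hn1, hn2⟩ := hnot
    have hRtop : totalRate S H ρ K ω ≠ ⊤ :=
      ((totalRate_le hS H hρ K ω).trans_lt ENNReal.ofReal_lt_top).ne
    set r := (totalRate S H ρ K ω).toReal with hr
    have hRr : totalRate S H ρ K ω = ENNReal.ofReal r := (ENNReal.ofReal_toReal hRtop).symm
    have hlow : ρ * (τ - d) < r := by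
      rw [hRr] at hn1
      exact (ENNReal.ofReal_lt_ofReal_iff_of_nonneg
        (mul_nonneg hρ.le (by linarith))).1 hn1
    have hup : r < ρ * (τ + d) := by
      have hle := totalRate_le hS H hρ K ω
      have hsum : 0 ≤ ∑ k ∈ Finset.range K, gain S (H k ω) :=
        Finset.sum_nonneg fun k _ => gain_nonneg hS _
      rw [hRr, ENNReal.ofReal_le_ofReal_iff (by positivity)] at hle
      calc r ≤ ρ / K * ∑ k ∈ Finset.range K, gain S (H k ω) := hle
        _ < ρ / K * (K * (τ + d)) := by gcongr
        _ = ρ * (τ + d) := by field_simp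
    set t := r / ρ with ht
    have hrt : r = ρ * t := by rw [ht]; field_simp
    rw [hrt] at hlow hup
    have ht1 : τ - d < t := lt_of_mul_lt_mul_left hlow hρ.le
    have ht2 : t < τ + d := lt_of_mul_lt_mul_left hup hρ.le
    obtain ⟨hlt, htpos⟩ := hball (y := t) (by rw [Real.dist_eq, abs_lt]; constructor <;> linarith)
    have hquot : ENNReal.ofReal ρ / totalRate S H ρ K ω = ENNReal.ofReal t⁻¹ := by
      rw [hRr, hrt, ← ENNReal.ofReal_div_of_pos (by positivity)]
      congr 1
      field_simp
    have hω' : ε ≤ edist (ENNReal.ofReal ρ / totalRate S H ρ K ω) (ENNReal.ofReal τ)⁻¹ := hω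
    rw [hquot, ← ENNReal.ofReal_inv_of_pos h0] at hω'
    exact hlt.not_ge hω'

theorem hasOutageExponent_iSup {η : ℝ} (hη : 0 < η) (hle : η⁻¹ ≤ ∑ i, ν i) :
    HasOutageExponent P S H ρ η
      (⨆ l : Set.Iic (0 : ℝ), (((l : ℝ) / η + logDet ν (-l) : ℝ) : EReal)) := by
  have ha : 0 < η⁻¹ := by positivity
  unfold HasOutageExponent
  simp_rw [div_eq_mul_inv ρ η]
  refine tendsto_order.2 ⟨fun b hb => ?_, fun b hb => ?_⟩
  · obtain ⟨⟨l, hl⟩, hbl⟩ := lt_iSup_iff.1 hb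
    obtain ⟨c, hbc, hcl⟩ := EReal.lt_iff_exists_real_btwn.1 hbl
    have hcl' : c < -(-l) * η⁻¹ + logDet ν (-l) := by
      rw [neg_neg, ← div_eq_mul_inv]; exact_mod_cast hcl
    filter_upwards [outageProb_le_exp hS hρ hX ha.le (neg_nonneg.2 hl) hcl',
      eventually_gt_atTop 0] with K hK hK0
    have hK' : (0 : EReal) < K := by exact_mod_cast hK0
    refine hbc.trans_le ?_
    rw [EReal.le_div_iff_mul_le hK' (EReal.natCast_ne_top K)]
    have hlog := ENNReal.log_monotone hK
    rw [ENNReal.log_ofReal_of_pos (Real.exp_pos _), Real.log_exp] at hlog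
    have := EReal.neg_le_neg_iff.2 hlog
    refine le_trans (le_of_eq ?_) this
    rw [← EReal.coe_neg, neg_neg, mul_comm, EReal.coe_mul]
    rfl
  · obtain ⟨c, hc, hcb⟩ := EReal.lt_iff_exists_real_btwn.1 hb
    -- The real `c` bounds every Chernoff exponent, and `c' - c` is the slack in Cramér's lower
    -- bound.
    obtain ⟨c', hcc', hcb'⟩ := EReal.lt_iff_exists_real_btwn.1 hcb
    have hcc : c < c' := by exact_mod_cast hcc'
    have hI (s : ℝ) (hs : 0 ≤ s) : -s * η⁻¹ + logDet ν s ≤ c := by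
      have h1 := (le_iSup (fun l : Set.Iic (0 : ℝ) =>
        (((l : ℝ) / η + logDet ν (-l) : ℝ) : EReal)) ⟨-s, neg_nonpos.2 hs⟩).trans hc.le
      have h2 : -s / η + logDet ν (- -s) ≤ c := by exact_mod_cast h1
      rwa [neg_neg, div_eq_mul_inv] at h2
    filter_upwards [exp_le_outageProb hS hρ hX ha hle hI (sub_pos.2 hcc),
      eventually_gt_atTop 0] with K hK hK0
    have hK' : (0 : EReal) < K := by exact_mod_cast hK0
    refine lt_of_le_of_lt ?_ hcb'
    rw [EReal.div_le_iff_le_mul hK' (EReal.natCast_ne_top K)]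
    have hlog := ENNReal.log_monotone hK
    rw [ENNReal.log_ofReal_of_pos (Real.exp_pos _), Real.log_exp, add_sub_cancel] at hlog
    have := EReal.neg_le_neg_iff.2 hlog
    refine le_trans this (le_of_eq ?_)
    rw [← EReal.coe_neg, neg_neg, EReal.coe_mul]
    rfl

end

end Outage

/-! ### Gains of correlated Gaussian fading matrices -/

section Fading

variable {nt nr : ℕ} {Ω : Type*} [MeasurableSpace Ω]

/-- The Hermitian matrix `Ψ^{1/2} (I ⊗ S) Ψ^{1/2}`, which has the nonzero eigenvalues of
`(I ⊗ S) Ψ`. -/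
def gainMatrix (S : Matrix (Fin nt) (Fin nt) ℂ) (Ψ : Matrix (Fin nr × Fin nt) (Fin nr × Fin nt) ℂ) :
    Matrix (Fin nr × Fin nt) (Fin nr × Fin nt) ℂ :=
  (CFC.sqrt Ψ)ᴴ * ((1 : Matrix (Fin nr) (Fin nr) ℂ) ⊗ₖ S) * CFC.sqrt Ψ

variable {S : Matrix (Fin nt) (Fin nt) ℂ} {Ψ : Matrix (Fin nr × Fin nt) (Fin nr × Fin nt) ℂ}

theorem posSemidef_gainMatrix (hS : S.PosSemidef)
    (Ψ : Matrix (Fin nr × Fin nt) (Fin nr × Fin nt) ℂ) :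
    (gainMatrix S Ψ).PosSemidef :=
  (PosSemidef.one.kronecker hS).conjTranspose_mul_mul_same _

theorem trace_gainMatrix (hΨ : Ψ.PosSemidef) :
    (gainMatrix S Ψ).trace = (((1 : Matrix (Fin nr) (Fin nr) ℂ) ⊗ₖ S) * Ψ).trace := by
  have hh : (CFC.sqrt Ψ)ᴴ = CFC.sqrt Ψ := (posSemidef_sqrt _).1
  rw [gainMatrix, hh, trace_mul_comm, ← Matrix.mul_assoc, sqrt_mul_sqrt hΨ, trace_mul_comm]

/-- From `det(1 + AB) = det(1 + BA)`. The product `(I ⊗ S) Ψ` need not be Hermitian, so reality and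
positivity of its determinants come from the Hermitian `gainMatrix`. -/
theorem det_one_add_smul_gainMatrix (hΨ : Ψ.PosSemidef) (t : ℂ) :
    (1 + t • gainMatrix S Ψ).det = (1 + t • (((1 : Matrix (Fin nr) (Fin nr) ℂ) ⊗ₖ S) * Ψ)).det := by
  have hh : (CFC.sqrt Ψ)ᴴ = CFC.sqrt Ψ := (posSemidef_sqrt _).1
  rw [gainMatrix, hh, ← Matrix.smul_mul, det_one_add_mul_comm, Matrix.mul_smul, ← Matrix.mul_assoc,
    sqrt_mul_sqrt hΨ, ← Matrix.smul_mul, det_one_add_mul_comm, Matrix.mul_smul]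

theorem det_gainMatrix_re (hS : S.PosSemidef) {s : ℝ} (hs : 0 ≤ s) :
    (1 + (s : ℂ) • gainMatrix S Ψ).det.re =
      Real.exp (logDet (posSemidef_gainMatrix hS Ψ).1.eigenvalues s) := by
  have hν := (posSemidef_gainMatrix hS Ψ).eigenvalues_nonneg
  rw [det_one_add_smul_eq_prod_eigenvalues (posSemidef_gainMatrix hS Ψ).1, logDet, Real.exp_sum]
  have (i : Fin nr × Fin nt) : Real.exp (Real.log (1 + s * (posSemidef_gainMatrix hS Ψ).1.eigenvalues i)) =
      1 + s * (posSemidef_gainMatrix hS Ψ).1.eigenvalues i := by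
    have := mul_nonneg hs (hν i)
    exact Real.exp_log (by positivity)
  simp_rw [this]
  norm_cast

variable {P : Measure Ω} [IsProbabilityMeasure P] {H : ℕ → Ω → Matrix (Fin nr) (Fin nt) ℂ}

omit [IsProbabilityMeasure P] in
/-- The gains of i.i.d. Gaussian fading matrices. -/
theorem isGainSequence_gain (hS : S.PosSemidef)
    (hlaw : ∀ k, HasLaw (fun ω => vec (H k ω)ᴴ) (complexGaussian Ψ) P)
    (hindep : iIndepFun (fun k ω => vec (H k ω)ᴴ) P) :
    IsGainSequence P (fun k ω => gain S (H k ω))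
      (posSemidef_gainMatrix hS Ψ).1.eigenvalues := by
  have hq := measurable_quadForm ((1 : Matrix (Fin nr) (Fin nr) ℂ) ⊗ₖ S)
  -- Transfers expectations of functions of the gain to a standard vector, where the quadratic form
  -- has matrix `gainMatrix S Ψ`.
  have hint {f : ℝ → ℝ} (hf : Measurable f) :
      ∫ ω, f (gain S (H 0 ω)) ∂P = ∫ w, f (quadForm (gainMatrix S Ψ) w) ∂(stdVec _) := by
    have hfq : Measurable fun v => f (quadForm ((1 : Matrix (Fin nr) (Fin nr) ℂ) ⊗ₖ S) v) :=
      hf.comp hq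
    have h1 := (hlaw 0).integral_comp (f := fun v => f (quadForm ((1 : Matrix _ _ ℂ) ⊗ₖ S) v))
      hfq.aestronglyMeasurable
    refine h1.trans ?_
    rw [complexGaussian, integral_map (measurable_mulVec _).aemeasurable hfq.aestronglyMeasurable]
    simp_rw [quadForm_mulVec]
    rfl
  have hgi : Integrable (fun ω => gain S (H 0 ω)) P := by
    have h1 : Integrable (quadForm ((1 : Matrix (Fin nr) (Fin nr) ℂ) ⊗ₖ S)) (complexGaussian Ψ) := by
      rw [complexGaussian, integrable_map_measure hq.aestronglyMeasurable
        (measurable_mulVec _).aemeasurable]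
      refine (integral_quadForm_stdVec (gainMatrix S Ψ)).1.congr (ae_of_all _ fun w => ?_)
      exact (quadForm_mulVec _ _ _).symm
    rw [← (hlaw 0).map_eq] at h1
    exact h1.comp_aemeasurable (hlaw 0).aemeasurable
  refine ⟨fun k => hq.comp_aemeasurable (hlaw k).aemeasurable, ?_, fun k => ?_, fun k ω =>
    gain_nonneg hS _, (posSemidef_gainMatrix hS Ψ).eigenvalues_nonneg, fun s hs => ?_, hgi, ?_⟩
  · exact hindep.comp (fun _ => quadForm ((1 : Matrix _ _ ℂ) ⊗ₖ S)) fun _ => hq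
  · exact ((hlaw k).identDistrib (hlaw 0)).comp hq
  · rw [mgf, hint (f := fun x => Real.exp (-s * x)) (by fun_prop)]
    simp_rw [neg_mul]
    rw [integral_exp_neg_quadForm (posSemidef_gainMatrix hS Ψ) hs, det_gainMatrix_re hS hs,
      Real.exp_neg]
  · rw [← trace_re_eq_sum]
    exact (hint (f := fun x => x) measurable_id).trans (integral_quadForm_stdVec _).2

end Fading

end WidebandMIMO

end

/-! ### The main theorem -/

theorem proposition2 {nt nr : ℕ} {Ω : Type*} [MeasurableSpace Ω] (P : Measure Ω)
    [IsProbabilityMeasure P]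
    (S : Matrix (Fin nt) (Fin nt) ℂ) (hS : S.PosSemidef) (hStr : S.trace = 1)
    (Ψ : Matrix (Fin nr × Fin nt) (Fin nr × Fin nt) ℂ) (hΨ : Ψ.PosSemidef)
    (H : ℕ → Ω → Matrix (Fin nr) (Fin nt) ℂ)
    (hlaw : ∀ k, HasLaw (fun ω => vec (H k ω)ᴴ) (WidebandMIMO.complexGaussian Ψ) P)
    (hindep : iIndepFun (fun k ω => vec (H k ω)ᴴ) P)
    (ρ : ℝ) (hρ : 0 < ρ) :
    -- the trace is real and nonnegative, the determinants are real and positive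
    (0 ≤ (((1 : Matrix (Fin nr) (Fin nr) ℂ) ⊗ₖ S) * Ψ).trace) ∧
    (∀ l : ℝ, l ≤ 0 → 0 < (1 - (l : ℂ) • (((1 : Matrix (Fin nr) (Fin nr) ℂ) ⊗ₖ S) * Ψ)).det) ∧
    -- the minimum energy per nat
    WidebandMIMO.minEnergyPerNat P S H ρ =
      (ENNReal.ofReal (((1 : Matrix (Fin nr) (Fin nr) ℂ) ⊗ₖ S) * Ψ).trace.re)⁻¹ ∧
    -- the energy per nat converges to it in probability
    TendstoInMeasure P (fun (K : ℕ) ω => ENNReal.ofReal ρ / WidebandMIMO.totalRate S H ρ K ω) atTop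
      (fun _ => WidebandMIMO.minEnergyPerNat P S H ρ) ∧
    -- the outage exponent
    ∀ η : ℝ, WidebandMIMO.minEnergyPerNat P S H ρ ≤ ENNReal.ofReal η →
      WidebandMIMO.HasOutageExponent P S H ρ η
        (⨆ l : Set.Iic (0 : ℝ), (((l : ℝ) / η + Real.log
          (1 - ((l : ℝ) : ℂ) • (((1 : Matrix (Fin nr) (Fin nr) ℂ) ⊗ₖ S) * Ψ)).det.re : ℝ) :
            EReal)) := by
  have hG := WidebandMIMO.posSemidef_gainMatrix hS Ψ
  have hX := WidebandMIMO.isGainSequence_gain hS hlaw hindep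
  have htr := WidebandMIMO.trace_gainMatrix (S := S) hΨ
  have hsum := WidebandMIMO.trace_re_eq_sum hG.1
  rw [htr] at hsum
  have hdet (l : ℝ) : (1 - (l : ℂ) • (((1 : Matrix (Fin nr) (Fin nr) ℂ) ⊗ₖ S) * Ψ)).det =
      (1 + ((-l : ℝ) : ℂ) • WidebandMIMO.gainMatrix S Ψ).det := by
    rw [WidebandMIMO.det_one_add_smul_gainMatrix hΨ, Complex.ofReal_neg, neg_smul, sub_eq_add_neg]
  have hmin := WidebandMIMO.minEnergyPerNat_eq hS hρ hX
  refine ⟨?_, fun l hl => ?_, ?_, ?_, fun η hη => ?_⟩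
  · rw [← htr]
    exact hG.trace_nonneg
  · rw [hdet]
    exact (PosDef.one.add_posSemidef
      (hG.smul (by exact_mod_cast neg_nonneg.2 hl))).det_pos
  · rw [hmin, hsum]
  · rw [hmin]
    exact WidebandMIMO.tendstoInMeasure_energyPerNat hS hρ hX
  · have hτ : 0 ≤ ∑ i, hG.1.eigenvalues i := Finset.sum_nonneg fun i _ => hG.eigenvalues_nonneg i
    rw [hmin] at hη
    -- The minimum energy is the inverse of a finite number, hence nonzero, which excludes `η ≤ 0`.
    have hη0 : 0 < η := by
      by_contra! h
      rw [ENNReal.ofReal_of_nonpos h] at hη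
      simp at hη
    have hle : η⁻¹ ≤ ∑ i, hG.1.eigenvalues i := by
      rwa [ENNReal.inv_le_iff_inv_le, ← ENNReal.ofReal_inv_of_pos hη0,
        ENNReal.ofReal_le_ofReal_iff hτ] at hη
    convert WidebandMIMO.hasOutageExponent_iSup hS hρ hX hη0 hle using 5 with l
    rw [hdet, WidebandMIMO.det_gainMatrix_re hS (neg_nonneg.2 l.2), Real.log_exp]
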